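/- **Model.** Time is slotted. Tasks arrive according to a discrete-time Markovian arrival process with phases $1,\dots,m$ and nonnegative $m\times m$ matrices $D_0\neq 0$, $D_1\neq 0$ such that $D=D_0+D_1$ is stochastic: $(D_0)_{ij}$ (resp. $(D_1)_{ij}$) is the probability of a phase change $i\to j$ in a slot without (resp. with) an arrival. Assume that $D$ has a unique stationary probability vector $\boldsymbol\pi$, and that the arrival rate $\lambda=\boldsymbol\pi D_1\mathbf e$ is positive. Queues 1 and 2 are first-in-first-out and have room for $N_1$ and $N_2$ tasks (the task in service included), $1\le N_1<N_2<\infty$. Transmission times (server 1), computation times (server 2) and vacations of server 1 are independent and have discrete phase-type distributions $(\beta_1,S_1)$, $(\beta_2,S_2)$, $(v,V)$ of finite orders; here the initial vectors are probability vectors (no mass at $0$), and $S_1,S_2,V$ are substochastic with $\mathbf I-S_1$, $\mathbf I-S_2$, $\mathbf I-V$ nonsingular. In a slot, a task whose transmission ends moves from queue 1 to queue 2, and a task whose computation ends leaves the system. An arriving task enters queue 1 if there is room in it (a place vacated in the same slot counts as room) and is rejected otherwise. When a transmission or a vacation of server 1 ends, or a task enters while server 1 is idle, then, with the queue lengths at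 the end of the slot, server 1 is idle if queue 1 is empty, starts a transmission if queue 1 is nonempty and queue 2 is not full, and starts a vacation if queue 1 is nonempty and queue 2 is full. Server 2 works whenever queue 2 is nonempty. The queue lengths, the arrival phase, and the current activities and phases of the two servers form a finite Markov chain with transition matrix $P$. Let $\mathbf x$ be a stationary distribution of it ($\mathbf x P=\mathbf x$, $\mathbf x\ge 0$, $\mathbf x\mathbf e=1$), and let $\mathbf x_{i_1 i_2}\mathbf e$ be the total mass that it gives to the states with $i_1$ tasks in queue 1 and $i_2$ tasks in queue 2. Let the chain start from $\mathbf x$, and consider any fixed slot. Let $P_{off}$ be the probability that a task enters queue 1 in that slot, given that a task arrives in it. Given that a task enters queue 1 in that slot, let $T\in\{1,2,\dots\}\cup\{\infty\}$ be the number of slots from the end of that slot until this task leaves queue 2, let $PW_n=P\{T=n\}$, and let $D_{ave}=E[T]$ be the average delay. **Proposition.** $P_{off}>0$, the average delay is finite, and $$D_{ave}=\sum_{n=1}^{\infty} n\,PW_n,\qquad\text{and}\qquad D_{ave}=\frac{\sum_{i_1=0}^{N_1}\sum_{i_2=0}^{N_2}(i_1+i_2)\,\mathbf x_{i_1 i_2}\mathbf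 e}{\lambda P_{off}} .$$ -/

import Mathlib

open MeasureTheory ProbabilityTheory
open scoped ENNReal

/-- A discrete-time Markovian arrival process with `m` phases: `D0 i j` (`D1 i j`) is the
probability of moving from phase `i` to phase `j` in a slot without (with) an arrival. -/
structure DMAP (m : ℕ) where
  D0 : Matrix (Fin m) (Fin m) ℝ
  D1 : Matrix (Fin m) (Fin m) ℝ
  D0_nonneg : ∀ i j, 0 ≤ D0 i j
  D1_nonneg : ∀ i j, 0 ≤ D1 i j
  row_sum : ∀ i, ∑ j, (D0 + D1) i j = 1
  D0_pos : ∃ i j, 0 < D0 i j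
  D1_pos : ∃ i j, 0 < D1 i j

namespace DMAP

variable {m : ℕ}

/-- `π` is a probability vector with `π D = π`, where `D = D0 + D1`. -/
def IsStationary (A : DMAP m) (π : Fin m → ℝ) : Prop :=
  (∀ i, 0 ≤ π i) ∧ ∑ i, π i = 1 ∧ Matrix.vecMul π (A.D0 + A.D1) = π

/-- The average number `π D1 e` of arrivals per slot. -/
def rate (A : DMAP m) (π : Fin m → ℝ) : ℝ :=
  ∑ j, Matrix.vecMul π A.D1 j

/-- The matrix of the phase changes with (`true`) or without (`false`) an arrival. -/
def step (A : DMAP m) (arrival : Bool) : Matrix (Fin m) (Fin m) ℝ :=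
  if arrival then A.D1 else A.D0

end DMAP

/-- A representation `(init, trans)` of order `n` of a discrete-time phase-type distribution on
`{1, 2, …}` (no mass at `0`). -/
structure DPH (n : ℕ) where
  init : Fin n → ℝ
  trans : Matrix (Fin n) (Fin n) ℝ
  init_nonneg : ∀ i, 0 ≤ init i
  init_sum : ∑ i, init i = 1
  trans_nonneg : ∀ i j, 0 ≤ trans i j
  row_sum_le : ∀ i, ∑ j, trans i j ≤ 1
  nonsingular : IsUnit (1 - trans)

/-- The absorption probabilities `e - T e`. -/
def DPH.exit {n : ℕ} (F : DPH n) (i : Fin n) : ℝ :=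
  1 - ∑ j, F.trans i j

/-- The parameters of the two-stage tandem queue: buffer sizes `N₁ < N₂`, the arrival process, and
the phase-type distributions of the transmission time (server 1), of the computation time
(server 2) and of one vacation of server 1. -/
structure TandemQueue where
  N₁ : ℕ
  N₂ : ℕ
  one_le_N₁ : 1 ≤ N₁
  N₁_lt_N₂ : N₁ < N₂
  m : ℕ
  n₁ : ℕ
  n₂ : ℕ
  l : ℕ
  arr : DMAP m
  trm : DPH n₁
  cmp : DPH n₂
  vac : DPH l

namespace TandemQueue

/-- Status of server 1: `none` is idle, `some (Sum.inl j)` is on vacation in phase `j`,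
`some (Sum.inr j)` is transmitting in phase `j`. -/
abbrev Status₁ (Q : TandemQueue) : Type := Option (Fin Q.l ⊕ Fin Q.n₁)

/-- Status of server 2: `none` is idle, `some j` is computing in phase `j`. -/
abbrev Status₂ (Q : TandemQueue) : Type := Option (Fin Q.n₂)

/-- Tuples (length of queue 1, length of queue 2, arrival phase, server 1, server 2). -/
abbrev RawState (Q : TandemQueue) : Type :=
  Fin (Q.N₁ + 1) × Fin (Q.N₂ + 1) × Fin Q.m × Q.Status₁ × Q.Status₂

/-- The tuples that are states: server 1 is idle exactly when queue 1 is empty, it can transmit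
only when queue 2 is not full, and server 2 is idle exactly when queue 2 is empty. -/
def Valid (Q : TandemQueue) (s : Q.RawState) : Prop :=
  ((s.1 : ℕ) = 0 ↔ s.2.2.2.1 = none) ∧
  ((s.2.1 : ℕ) = Q.N₂ → ∀ j : Fin Q.n₁, s.2.2.2.1 ≠ some (Sum.inr j)) ∧
  ((s.2.1 : ℕ) = 0 ↔ s.2.2.2.2 = none)

instance (Q : TandemQueue) : DecidablePred Q.Valid :=
  fun _ => inferInstanceAs (Decidable (_ ∧ _ ∧ _))

/-- The state space. -/
abbrev State (Q : TandemQueue) : Type := {s : Q.RawState // Q.Valid s}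

section State

variable {Q : TandemQueue}

/-- Number of tasks in queue 1, the one in transmission included. -/
def State.len₁ (s : Q.State) : ℕ := (s.1.1 : ℕ)

/-- Number of tasks in queue 2, the one in computation included. -/
def State.len₂ (s : Q.State) : ℕ := (s.1.2.1 : ℕ)

/-- The phase of the arrival process. -/
def State.phase (s : Q.State) : Fin Q.m := s.1.2.2.1

/-- The status of server 1. -/
def State.srv₁ (s : Q.State) : Q.Status₁ := s.1.2.2.2.1

/-- The status of server 2. -/
def State.srv₂ (s : Q.State) : Q.Status₂ := s.1.2.2.2.2

end State

/-- What happens in one slot: whether a task arrives, whether the current activity (transmission or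
vacation) of server 1 ends, whether the current computation of server 2 ends. -/
abbrev Event : Type := Bool × Bool × Bool

/-- A task arrives (it may be rejected). -/
def Event.arrival (e : Event) : Bool := e.1

/-- The current transmission or vacation of server 1 ends. -/
def Event.end₁ (e : Event) : Bool := e.2.1

/-- The current computation of server 2 ends, that is, a task leaves the system. -/
def Event.end₂ (e : Event) : Bool := e.2.2

/-- Number (0 or 1) of tasks that move from queue 1 to queue 2 in the slot. -/
def moved (Q : TandemQueue) (s : Q.State) (e : Event) : ℕ :=
  match s.srv₁ with
  | some (Sum.inr _) => if e.end₁ then 1 else 0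
  | _ => 0

/-- A task arrives in the slot and finds room in queue 1. A place that is vacated in the same slot
is available to it. -/
def Admits (Q : TandemQueue) (s : Q.State) (e : Event) : Prop :=
  e.arrival = true ∧ s.len₁ - Q.moved s e < Q.N₁

instance (Q : TandemQueue) (s : Q.State) (e : Event) : Decidable (Q.Admits s e) :=
  inferInstanceAs (Decidable (_ ∧ _))

/-- Length of queue 1 after the slot. -/
def next₁ (Q : TandemQueue) (s : Q.State) (e : Event) : ℕ :=
  s.len₁ - Q.moved s e + if Q.Admits s e then 1 else 0

/-- Length of queue 2 after the slot. -/
def next₂ (Q : TandemQueue) (s : Q.State) (e : Event) : ℕ :=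
  s.len₂ + Q.moved s e - if e.end₂ then 1 else 0

/-- Probability that server 1, having no activity in progress, takes the status `a` when the queues
have lengths `i₁` and `i₂`: idle if queue 1 is empty; otherwise a new transmission if queue 2 is not
full and a new vacation if queue 2 is full. -/
def start₁ (Q : TandemQueue) (i₁ i₂ : ℕ) (a : Q.Status₁) : ℝ :=
  match a with
  | none => if i₁ = 0 then 1 else 0
  | some (Sum.inl j) => if i₁ ≠ 0 ∧ i₂ = Q.N₂ then Q.vac.init j else 0
  | some (Sum.inr j) => if i₁ ≠ 0 ∧ i₂ ≠ Q.N₂ then Q.trm.init j else 0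

/-- Probability that server 2, having no computation in progress, takes the status `b` when queue 2
has length `i₂`. -/
def start₂ (Q : TandemQueue) (i₂ : ℕ) (b : Q.Status₂) : ℝ :=
  match b with
  | none => if i₂ = 0 then 1 else 0
  | some j => if i₂ ≠ 0 then Q.cmp.init j else 0

/-- Probability that the activity of server 1 with status `a` ends (`end₁ = true`) or not in the
slot and that its status becomes `a'`; `i₁`, `i₂` are the queue lengths after the slot. -/
def step₁ (Q : TandemQueue) (i₁ i₂ : ℕ) (a : Q.Status₁) (end₁ : Bool) (a' : Q.Status₁) : ℝ :=
  match a, end₁ with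
  | none, true => 0
  | none, false => Q.start₁ i₁ i₂ a'
  | some (Sum.inl j), true => Q.vac.exit j * Q.start₁ i₁ i₂ a'
  | some (Sum.inl j), false =>
      match a' with
      | some (Sum.inl j') => Q.vac.trans j j'
      | _ => 0
  | some (Sum.inr j), true => Q.trm.exit j * Q.start₁ i₁ i₂ a'
  | some (Sum.inr j), false =>
      match a' with
      | some (Sum.inr j') => Q.trm.trans j j'
      | _ => 0

/-- The analogue of `step₁` for server 2. -/
def step₂ (Q : TandemQueue) (i₂ : ℕ) (b : Q.Status₂) (end₂ : Bool) (b' : Q.Status₂) : ℝ :=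
  match b, end₂ with
  | none, true => 0
  | none, false => Q.start₂ i₂ b'
  | some j, true => Q.cmp.exit j * Q.start₂ i₂ b'
  | some j, false =>
      match b' with
      | some j' => Q.cmp.trans j j'
      | none => 0

/-- Probability that, from the state `s`, the events of the slot are `e` and the next state
is `s'`. -/
def kernel (Q : TandemQueue) (s : Q.State) (e : Event) (s' : Q.State) : ℝ :=
  if s'.len₁ = Q.next₁ s e ∧ s'.len₂ = Q.next₂ s e then
    Q.arr.step e.arrival s.phase s'.phase *
      Q.step₁ s'.len₁ s'.len₂ s.srv₁ e.end₁ s'.srv₁ *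
      Q.step₂ s'.len₂ s.srv₂ e.end₂ s'.srv₂
  else 0

/-- The one-step transition matrix of the chain of states. -/
def P (Q : TandemQueue) : Matrix Q.State Q.State ℝ :=
  fun s s' => ∑ e : Event, Q.kernel s e s'

/-- `x` is a probability vector with `x P = x`. -/
def IsStationary (Q : TandemQueue) (x : Q.State → ℝ) : Prop :=
  (∀ s, 0 ≤ x s) ∧ ∑ s, x s = 1 ∧ Matrix.vecMul x Q.P = x

/-- The stationary probability `x_{i₁ i₂} e` of the queue lengths `i₁` and `i₂`. -/
def levelProb (Q : TandemQueue) (x : Q.State → ℝ) (i₁ i₂ : ℕ) : ℝ :=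
  ∑ s : Q.State, if s.len₁ = i₁ ∧ s.len₂ = i₂ then x s else 0

/-- The stationary mean of the total number of tasks in both queues. -/
def meanNumber (Q : TandemQueue) (x : Q.State → ℝ) : ℝ :=
  ∑ i₁ ∈ Finset.range (Q.N₁ + 1), ∑ i₂ ∈ Finset.range (Q.N₂ + 1),
    ((i₁ : ℝ) + (i₂ : ℝ)) * Q.levelProb x i₁ i₂

section Run

variable {Ω : Type*} [MeasurableSpace Ω]

/-- `X i` is the state at time `t_i` and `E i` the events of the slot from `t_i` to `t_{i+1}` of the
tandem queue with initial distribution `x`: together they have the law of the Markov chain with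
the transition probabilities `kernel`. -/
structure IsRun (Q : TandemQueue) (x : Q.State → ℝ) (μ : Measure Ω)
    (X : ℕ → Ω → Q.State) (E : ℕ → Ω → Event) : Prop where
  measurable_state : ∀ i s, MeasurableSet (X i ⁻¹' {s})
  measurable_event : ∀ i e, MeasurableSet (E i ⁻¹' {e})
  law : ∀ (n : ℕ) (s : ℕ → Q.State) (e : ℕ → Event),
    μ {ω | (∀ i ≤ n, X i ω = s i) ∧ ∀ i < n, E i ω = e i} =
      ENNReal.ofReal (x (s 0) * ∏ i ∈ Finset.range n, Q.kernel (s i) (e i) (s (i + 1)))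

/-- A task arrives in slot `k`. -/
def arrives (E : ℕ → Ω → Event) (k : ℕ) : Set Ω :=
  {ω | (E k ω).arrival = true}

/-- A task arrives and enters queue 1 in slot `k`. -/
def enters (Q : TandemQueue) (X : ℕ → Ω → Q.State) (E : ℕ → Ω → Event) (k : ℕ) : Set Ω :=
  {ω | Q.Admits (X k ω) (E k ω)}

/-- Number of tasks that leave queue 2 during the `n` slots that follow time `t_k`. -/
def departures (E : ℕ → Ω → Event) (k n : ℕ) (ω : Ω) : ℕ :=
  ∑ i ∈ Finset.range n, if (E (k + i) ω).end₂ then 1 else 0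

/-- The delay, in slots, of the task that enters in slot `k`, and so is the last of all tasks in the
system at time `t_{k+1}`: as both queues are first-in-first-out, it leaves when as many tasks have
left as were then present. The value is `⊤` if this never happens. -/
noncomputable def delay (Q : TandemQueue) (X : ℕ → Ω → Q.State) (E : ℕ → Ω → Event) (k : ℕ)
    (ω : Ω) : ℕ∞ :=
  ⨅ (n : ℕ) (_ : (X (k + 1) ω).len₁ + (X (k + 1) ω).len₂ ≤ departures E (k + 1) n ω), (n : ℕ∞)

/-- The offloading ratio: the probability that a task arriving in slot `k` enters queue 1. -/
noncomputable def offloadingRatio (Q : TandemQueue) (μ : Measure Ω) (X : ℕ → Ω → Q.State)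
    (E : ℕ → Ω → Event) (k : ℕ) : ℝ :=
  (μ[|arrives E k] (Q.enters X E k)).toReal

/-- The probability that the delay of a task that enters in slot `k` is `n` slots. -/
noncomputable def delayProb (Q : TandemQueue) (μ : Measure Ω) (X : ℕ → Ω → Q.State)
    (E : ℕ → Ω → Event) (k n : ℕ) : ℝ≥0∞ :=
  μ[|Q.enters X E k] {ω | Q.delay X E k ω = (n : ℕ∞)}

/-- The average delay: the expected delay of a task that enters in slot `k`. -/
noncomputable def averageDelay (Q : TandemQueue) (μ : Measure Ω) (X : ℕ → Ω → Q.State)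
    (E : ℕ → Ω → Event) (k : ℕ) : ℝ≥0∞ :=
  ∫⁻ ω, ((Q.delay X E k ω : ℕ∞) : ℝ≥0∞) ∂(μ[|Q.enters X E k])

end Run

end TandemQueue

/-! Little's law, by counting. Let `b n` be the mean number of the tasks present at a given time
that are still in the system `n` slots later; by stationarity it does not depend on that time. The
tasks present at time `k + 1` are those present at time `k` that do not leave in slot `k`, and the
task, if any, that enters in slot `k`. Under first-in-first-out service this last one leaves after
all the others, so it accounts for one unit of `b n` exactly if it stays for more than `n` slots:
`b n = b (n + 1) + P(a task enters, T > n)`. As `b n → 0`, summation over `n` gives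
`E[T; a task enters] = b 0`, the mean number of tasks, and it remains to divide by
`P(a task enters) = λ P_off`.

That `b n → 0` follows from a fact on finite chains: if `M` is a substochastic matrix, `M ^ n 1`
tends to `0` unless some set of states conserves mass. No set of states with a nonempty system does
so without departures. The computations would have to go on forever, hence queue 2 is empty; then no
transmission can end, nor can a vacation, after which a transmission would start; but an activity
with a nonsingular phase-type distribution cannot go on forever. -/

section Substochastic

variable {ι : Type*} [Fintype ι] {T : Matrix ι ι ℝ}

/-- A closed class of a substochastic matrix: a nonempty set of indices that the chain with
transition matrix `T` cannot leave, neither for another index nor by being killed. -/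
def IsClosedClass (T : Matrix ι ι ℝ) (J : Set ι) : Prop :=
  J.Nonempty ∧ ∀ i ∈ J, ∑ j, T i j = 1 ∧ ∀ j, 0 < T i j → j ∈ J

open Matrix in
/-- At a minimum over `J` of the solution `w` of `(1 - T) w = 1` one would have
`w = 1 + T w ≥ 1 + w`. -/
lemma not_isClosedClass_of_isUnit [DecidableEq ι] (hT : ∀ i j, 0 ≤ T i j) (hunit : IsUnit (1 - T))
    (J : Set ι) : ¬ IsClosedClass T J := by
  rintro ⟨hJ, hclosed⟩
  obtain ⟨B, hB⟩ := hunit.exists_right_inv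
  set w : ι → ℝ := B *ᵥ 1
  have hw : w - T *ᵥ w = 1 := by
    calc w - T *ᵥ w = (1 - T) *ᵥ w := by rw [sub_mulVec, one_mulVec]
      _ = 1 := by rw [mulVec_mulVec, hB, one_mulVec]
  obtain ⟨i, hi, hmin⟩ := Set.exists_min_image J w J.toFinite hJ
  have hle : w i ≤ (T *ᵥ w) i :=
    calc w i = ∑ j, T i j * w i := by rw [← Finset.sum_mul, (hclosed i hi).1, one_mul]
      _ ≤ ∑ j, T i j * w j := Finset.sum_le_sum fun j _ => by
        rcases (hT i j).eq_or_lt with h0 | hpos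
        · simp [← h0]
        · exact mul_le_mul_of_nonneg_left (hmin j ((hclosed i hi).2 j hpos)) hpos.le
  have := congrFun hw i
  simp only [Pi.sub_apply, Pi.one_apply] at this
  linarith

open Matrix in
lemma isClosedClass_of_mulVec_eq (hT : ∀ i j, 0 ≤ T i j) (hrow : ∀ i, ∑ j, T i j ≤ 1)
    {u : ι → ℝ} (hu : T *ᵥ u = u) {i₀ : ι} (hmax : ∀ i, u i ≤ u i₀) (hpos : 0 < u i₀) :
    IsClosedClass T {i | u i = u i₀} := by
  refine ⟨⟨i₀, rfl⟩, fun i hi => ?_⟩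
  have hle : ∀ j ∈ Finset.univ, T i j * u j ≤ T i j * u i₀ := fun j _ =>
    mul_le_mul_of_nonneg_left (hmax j) (hT i j)
  have hfix : ∑ j, T i j * u j = u i₀ := (congrFun hu i).trans hi
  have hsum : ∑ j, T i j = 1 := by
    refine (hrow i).antisymm (le_of_mul_le_mul_right ?_ hpos)
    rw [one_mul, Finset.sum_mul]
    exact hfix.symm.trans_le (Finset.sum_le_sum hle)
  refine ⟨hsum, fun j hj => ?_⟩
  have heq : ∑ j, T i j * u j = ∑ j, T i j * u i₀ := by
    rw [hfix, ← Finset.sum_mul, hsum, one_mul]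
  exact mul_left_cancel₀ hj.ne' ((Finset.sum_eq_sum_iff_of_le hle).1 heq j (Finset.mem_univ j))

open Matrix in
lemma pow_mulVec_one_nonneg [DecidableEq ι] (hT : ∀ i j, 0 ≤ T i j) (n : ℕ) :
    0 ≤ T ^ n *ᵥ (1 : ι → ℝ) := by
  induction n with
  | zero => simp
  | succ n ih =>
    rw [pow_succ', ← mulVec_mulVec]
    exact fun i => Finset.sum_nonneg fun j _ => mul_nonneg (hT i j) (ih j)

open Matrix in
lemma antitone_pow_mulVec_one [DecidableEq ι] (hT : ∀ i j, 0 ≤ T i j)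
    (hrow : ∀ i, ∑ j, T i j ≤ 1) : Antitone fun n : ℕ => T ^ n *ᵥ (1 : ι → ℝ) := by
  have hmono : Monotone (T *ᵥ ·) := fun v w hvw i =>
    Finset.sum_le_sum fun j _ => mul_le_mul_of_nonneg_left (hvw j) (hT i j)
  refine antitone_nat_of_succ_le fun n => ?_
  induction n with
  | zero =>
    rw [zero_add, pow_one, pow_zero, one_mulVec]
    exact fun i => (dotProduct_one (T i)).trans_le (hrow i)
  | succ n ih =>
    rw [pow_succ' T n, pow_succ' T (n + 1), ← mulVec_mulVec, ← mulVec_mulVec]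
    exact hmono ih

open Matrix Filter Topology in
lemma tendsto_pow_mulVec_one [DecidableEq ι] (hT : ∀ i j, 0 ≤ T i j)
    (hrow : ∀ i, ∑ j, T i j ≤ 1) (hclosed : ∀ J, ¬ IsClosedClass T J) :
    Tendsto (fun n : ℕ => T ^ n *ᵥ (1 : ι → ℝ)) atTop (𝓝 0) := by
  have hnonneg (n : ℕ) := pow_mulVec_one_nonneg hT n
  obtain ⟨u, hlim⟩ : ∃ u : ι → ℝ, Tendsto (fun n : ℕ => T ^ n *ᵥ (1 : ι → ℝ)) atTop (𝓝 u) :=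
    ⟨_, tendsto_pi_nhds.2 fun i => tendsto_atTop_ciInf
      (fun _ _ h => antitone_pow_mulVec_one hT hrow h i)
      ⟨0, Set.forall_mem_range.2 fun n => hnonneg n i⟩⟩
  have hfix : T *ᵥ u = u := by
    refine tendsto_nhds_unique ?_ (hlim.comp (tendsto_add_atTop_nat 1))
    simp only [Function.comp_def, pow_succ', ← mulVec_mulVec]
    exact ((Continuous.matrix_mulVec continuous_const continuous_id).tendsto u).comp hlim
  have hu : 0 ≤ u := ge_of_tendsto' hlim hnonneg
  suffices u = 0 from this ▸ hlim
  by_contra hne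
  obtain ⟨i₁, hi₁⟩ := Function.ne_iff.1 hne
  obtain ⟨i₀, -, hmax⟩ := Finset.exists_max_image Finset.univ u ⟨i₁, Finset.mem_univ i₁⟩
  exact hclosed _ (isClosedClass_of_mulVec_eq hT hrow hfix (fun i => hmax i (Finset.mem_univ i))
    (((hu i₁).lt_of_ne' hi₁).trans_le (hmax i₁ (Finset.mem_univ i₁))))

end Substochastic

section FirstPassage

/-- The first time at which the counting function `D` reaches the level `c`, and `⊤` if it never
does. -/
noncomputable def firstPassage (D : ℕ → ℕ) (c : ℕ) : ℕ∞ :=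
  ⨅ (n : ℕ) (_ : c ≤ D n), (n : ℕ∞)

lemma natCast_lt_firstPassage_iff {D : ℕ → ℕ} (hD : Monotone D) {c n : ℕ} :
    (n : ℕ∞) < firstPassage D c ↔ D n < c := by
  rw [← not_iff_not, not_lt, not_lt]
  refine ⟨fun h => ?_, fun h => iInf₂_le n h⟩
  by_contra! hlt
  have : ((n + 1 : ℕ) : ℕ∞) ≤ firstPassage D c := le_iInf₂ fun i hi => by
    by_contra! hin
    have := hD (Nat.lt_succ_iff.1 (Nat.cast_lt.1 hin))
    omega
  exact absurd (Nat.cast_le.1 (this.trans h)) (by omega)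

lemma firstPassage_ne_top {D : ℕ → ℕ} {c n : ℕ} (h : c ≤ D n) : firstPassage D c ≠ ⊤ :=
  ((iInf₂_le n h).trans_lt (ENat.natCast_lt_top n)).ne

lemma exists_le_sum_range {N d : ℕ → ℕ} (hbal : ∀ i, N i ≤ N (i + 1) + d i)
    (hrec : ∀ k, ∃ i, N (k + i) = 0 ∨ d (k + i) ≠ 0) : ∃ n, N 0 ≤ ∑ i ∈ Finset.range n, d i := by
  have hstock : ∀ n, N 0 ≤ N n + ∑ i ∈ Finset.range n, d i := fun n => by
    induction n with
    | zero => simp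
    | succ n ih => rw [Finset.sum_range_succ]; have := hbal n; omega
  suffices ∀ r ≤ N 0, ∃ n, r ≤ ∑ i ∈ Finset.range n, d i from this _ le_rfl
  intro r hr
  induction r with
  | zero => exact ⟨0, le_rfl⟩
  | succ r ih =>
    obtain ⟨n, hn⟩ := ih (by omega)
    obtain ⟨i, hi⟩ := hrec n
    have hmono : ∑ j ∈ Finset.range n, d j ≤ ∑ j ∈ Finset.range (n + i), d j :=
      Finset.sum_le_sum_of_subset (Finset.range_mono (by omega))
    refine ⟨n + i + 1, ?_⟩
    rw [Finset.sum_range_succ]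
    have := hstock (n + i)
    omega

end FirstPassage

section ENatMean

lemma toENNReal_eq_tsum_lt (t : ℕ∞) :
    (t : ℝ≥0∞) = ∑' n : ℕ, {t : ℕ∞ | n < t}.indicator 1 t := by
  induction t using ENat.recTopCoe with
  | top => simp
  | coe m =>
    rw [tsum_eq_sum (s := Finset.range m) fun n hn => Set.indicator_of_notMem (by simpa using hn) 1,
      Finset.sum_congr rfl fun n hn => Set.indicator_of_mem (by simpa using hn) 1]
    simp

lemma toENNReal_eq_tsum_mul {t : ℕ∞} (ht : t ≠ ⊤) :
    (t : ℝ≥0∞) =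
      ∑' n : ℕ, ((n + 1 : ℕ) : ℝ≥0∞) * {t : ℕ∞ | t = (n + 1 : ℕ)}.indicator 1 t := by
  lift t to ℕ using ht
  rcases t with _ | m
  · simp
  · rw [tsum_eq_single m fun n hn => by simp [hn.symm]]
    simp

variable {Ω : Type*} [MeasurableSpace Ω] {T : Ω → ℕ∞}

lemma measurable_of_natCast_lt (hT : ∀ n : ℕ, MeasurableSet {ω | (n : ℕ∞) < T ω}) :
    Measurable T := by
  refine ENat.measurable_iff.2 fun n => ?_
  have hfiber : T ⁻¹' {(n : ℕ∞)} =
      {ω | (n : ℕ∞) < T ω}ᶜ ∩ ⋂ (m : ℕ) (_ : m < n), {ω | (m : ℕ∞) < T ω} := by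
    ext ω
    simp only [Set.mem_preimage, Set.mem_singleton_iff, Set.mem_inter_iff, Set.mem_compl_iff,
      Set.mem_iInter, Set.mem_ofPred_eq, not_lt]
    refine ⟨fun h => ⟨h.le, fun m hm => h ▸ Nat.cast_lt.2 hm⟩, fun ⟨hle, hlt⟩ => ?_⟩
    lift T ω to ℕ using (hle.trans_lt (ENat.natCast_lt_top n)).ne with t
    exact Nat.cast_inj.2 <| (Nat.cast_le.1 hle).antisymm <| not_lt.1 fun h =>
      lt_irrefl _ (hlt t h)
  rw [hfiber]
  exact (hT n).compl.inter (.iInter fun m => .iInter fun _ => hT m)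

variable {ν : Measure Ω}

lemma lintegral_toENNReal_eq_tsum_lt (hT : Measurable T) :
    ∫⁻ ω, (T ω : ℝ≥0∞) ∂ν = ∑' n : ℕ, ν {ω | (n : ℕ∞) < T ω} := by
  have hset (n : ℕ) : MeasurableSet {ω | (n : ℕ∞) < T ω} :=
    hT (.of_discrete (s := {t : ℕ∞ | n < t}))
  simp only [toENNReal_eq_tsum_lt]
  exact (lintegral_tsum fun n => (measurable_one.indicator (hset n)).aemeasurable).trans
    (tsum_congr fun n => lintegral_indicator_one (hset n))

lemma lintegral_toENNReal_eq_tsum_mul (hT : Measurable T) (hfin : ∀ᵐ ω ∂ν, T ω ≠ ⊤) :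
    ∫⁻ ω, (T ω : ℝ≥0∞) ∂ν = ∑' n : ℕ, ((n + 1 : ℕ) : ℝ≥0∞) * ν {ω | T ω = (n + 1 : ℕ)} := by
  have hset (n : ℕ) : MeasurableSet {ω | T ω = (n + 1 : ℕ)} :=
    hT (.of_discrete (s := {t : ℕ∞ | t = (n + 1 : ℕ)}))
  rw [lintegral_congr_ae (hfin.mono fun ω hω => toENNReal_eq_tsum_mul hω)]
  refine (lintegral_tsum fun n =>
    ((measurable_one.indicator (hset n)).const_mul _).aemeasurable).trans (tsum_congr fun n => ?_)
  rw [← lintegral_indicator_one (hset n)]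
  exact lintegral_const_mul _ (measurable_one.indicator (hset n))

end ENatMean

/-- The process of states `X` and labels `E` has the law of the chain that starts from `x` and in
which `K s e s'` is the probability of a move from `s` to `s'` with label `e`; neither `x` nor `K`
need be normalized. -/
structure IsLabelledChain {Ω S L : Type*} [MeasurableSpace Ω] [MeasurableSpace S]
    [MeasurableSpace L] (x : S → ℝ) (K : S → L → S → ℝ) (μ : Measure Ω)
    (X : ℕ → Ω → S) (E : ℕ → Ω → L) : Prop where
  measurable_state : ∀ i, Measurable (X i)
  measurable_label : ∀ i, Measurable (E i)
  law : ∀ (n : ℕ) (s : ℕ → S) (e : ℕ → L),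
    μ {ω | (∀ i ≤ n, X i ω = s i) ∧ ∀ i < n, E i ω = e i} =
      ENNReal.ofReal (x (s 0) * ∏ i ∈ Finset.range n, K (s i) (e i) (s (i + 1)))

section StepMatrix

variable {S L : Type*} [Fintype L]

/-- The substochastic matrix of the moves of a labelled chain for which `p` holds. -/
def stepMatrix (K : S → L → S → ℝ) (p : S → L → Prop) [DecidableRel p] : Matrix S S ℝ :=
  fun s s' => ∑ e, if p s e then K s e s' else 0

/-- The transition matrix of the states of a labelled chain. -/
def transitionMatrix (K : S → L → S → ℝ) : Matrix S S ℝ :=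
  fun s s' => ∑ e, K s e s'

variable {K : S → L → S → ℝ} {p : S → L → Prop} [DecidableRel p]

lemma stepMatrix_nonneg (hK : ∀ s e s', 0 ≤ K s e s') (s s' : S) : 0 ≤ stepMatrix K p s s' :=
  Finset.sum_nonneg fun e _ => by split_ifs; exacts [hK s e s', le_rfl]

variable [Fintype S]

lemma sum_stepMatrix (s : S) :
    ∑ s', stepMatrix K p s s' = ∑ e, if p s e then ∑ s', K s e s' else 0 := by
  simp only [stepMatrix]
  rw [Finset.sum_comm]
  exact Finset.sum_congr rfl fun e _ => by split_ifs <;> simp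

open Matrix in
lemma dotProduct_stepMatrix_mulVec (x u : S → ℝ) :
    x ⬝ᵥ stepMatrix K p *ᵥ u =
      ∑ q : S × L, if p q.1 q.2 then (fun s' => x q.1 * K q.1 q.2 s') ⬝ᵥ u else 0 := by
  rw [Fintype.sum_prod_type]
  refine Finset.sum_congr rfl fun s _ => ?_
  simp only [mulVec, dotProduct, stepMatrix, Finset.sum_mul, ite_mul, zero_mul]
  rw [Finset.sum_comm, Finset.mul_sum]
  refine Finset.sum_congr rfl fun e _ => ?_
  split_ifs
  · simp only [Finset.mul_sum, mul_assoc]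
  · simp only [Finset.sum_const_zero, mul_zero]

lemma sum_stepMatrix_le (hK : ∀ s e s', 0 ≤ K s e s') (hsum : ∀ s, ∑ e, ∑ s', K s e s' = 1)
    (s : S) : ∑ s', stepMatrix K p s s' ≤ 1 := by
  rw [sum_stepMatrix, ← hsum s]
  refine Finset.sum_le_sum fun e _ => ?_
  split_ifs
  exacts [le_rfl, Finset.sum_nonneg fun s' _ => hK s e s']

lemma IsClosedClass.of_pos (hK : ∀ s e s', 0 ≤ K s e s') (hsum : ∀ s, ∑ e, ∑ s', K s e s' = 1)
    {A : Set S} (hA : IsClosedClass (stepMatrix K p) A) {s s' : S} {e : L} (hs : s ∈ A)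
    (hpos : 0 < K s e s') : p s e ∧ s' ∈ A := by
  have hnonneg (e) : 0 ≤ ∑ s', K s e s' := Finset.sum_nonneg fun s' _ => hK s e s'
  have hp : p s e := by
    by_contra hp
    have hlt : ∑ s', stepMatrix K p s s' < 1 := by
      rw [sum_stepMatrix, ← hsum s]
      refine Finset.sum_lt_sum (fun e _ => ?_) ⟨e, Finset.mem_univ e, ?_⟩
      · split_ifs
        exacts [le_rfl, hnonneg e]
      · rw [if_neg hp]
        exact Finset.sum_pos' (fun s' _ => hK s e s') ⟨s', Finset.mem_univ s', hpos⟩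
    exact hlt.ne (hA.2 s hs).1
  refine ⟨hp, (hA.2 s hs).2 s' ?_⟩
  refine Finset.sum_pos' (fun e _ => ?_) ⟨e, Finset.mem_univ e, by rwa [if_pos hp]⟩
  split_ifs
  exacts [hK s e s', le_rfl]

end StepMatrix

namespace IsLabelledChain

open Matrix

variable {Ω S L : Type*} [MeasurableSpace Ω]
  [MeasurableSpace S] [MeasurableSpace L]
  {x : S → ℝ} {K : S → L → S → ℝ} {μ : Measure Ω} {X : ℕ → Ω → S} {E : ℕ → Ω → L}

lemma measure_state [Nonempty L] (h : IsLabelledChain x K μ X E) (s : S) :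
    μ (X 0 ⁻¹' {s}) = ENNReal.ofReal (x s) := by
  have hlaw := h.law 0 (fun _ => s) (Classical.arbitrary _)
  simp only [nonpos_iff_eq_zero, forall_eq, not_lt_zero, IsEmpty.forall_iff, implies_true, and_true,
    Finset.range_zero, Finset.prod_empty, mul_one] at hlaw
  exact hlaw

variable [MeasurableSingletonClass S]

lemma lintegral_state [Nonempty L] [Countable S] (h : IsLabelledChain x K μ X E)
    (f : S → ℝ≥0∞) : ∫⁻ ω, f (X 0 ω) ∂μ = ∑' s, f s * ENNReal.ofReal (x s) := by
  rw [← lintegral_map .of_discrete (h.measurable_state 0), lintegral_countable']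
  exact tsum_congr fun s => by
    rw [Measure.map_apply (h.measurable_state 0) (measurableSet_singleton s), h.measure_state]

lemma measure_univ [Nonempty L] [Fintype S] (h : IsLabelledChain x K μ X E) (hx : ∀ s, 0 ≤ x s) :
    μ Set.univ = ENNReal.ofReal (∑ s, x s) := by
  rw [← lintegral_one, h.lintegral_state fun _ => 1, tsum_fintype,
    ENNReal.ofReal_sum_of_nonneg fun s _ => hx s]
  simp only [one_mul]

variable [MeasurableSingletonClass L]

lemma measurableSet_step (h : IsLabelledChain x K μ X E) (q : S × L) :
    MeasurableSet {ω | (X 0 ω, E 0 ω) = q} :=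
  (h.measurable_state 0).prodMk (h.measurable_label 0) (measurableSet_singleton q)

lemma restrict (h : IsLabelledChain x K μ X E) (q : S × L) :
    IsLabelledChain (fun s' => x q.1 * K q.1 q.2 s') K (μ.restrict {ω | (X 0 ω, E 0 ω) = q})
      (fun i => X (i + 1)) (fun i => E (i + 1)) where
  measurable_state i := h.measurable_state (i + 1)
  measurable_label i := h.measurable_label (i + 1)
  law n s e := by
    rw [Measure.restrict_apply' (h.measurableSet_step q)]
    convert h.law (n + 1) (fun i => i.casesOn q.1 s) (fun i => i.casesOn q.2 e) using 2
    · ext ω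
      simp only [Set.mem_inter_iff, Set.mem_ofPred_eq, Prod.ext_iff]
      constructor
      · rintro ⟨⟨hs, he⟩, hs₀, he₀⟩
        exact ⟨fun i hi => by cases i; exacts [hs₀, hs _ (Nat.le_of_succ_le_succ hi)],
          fun i hi => by cases i; exacts [he₀, he _ (Nat.lt_of_succ_lt_succ hi)]⟩
      · rintro ⟨hs, he⟩
        exact ⟨⟨fun i hi => hs (i + 1) (by omega), fun i hi => he (i + 1) (by omega)⟩,
          hs 0 (by omega), he 0 (by omega)⟩
    · rw [Finset.prod_range_succ', mul_comm (Finset.prod _ _), ← mul_assoc]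
      rfl

lemma sum_restrict [Countable S] [Countable L] (h : IsLabelledChain x K μ X E) :
    Measure.sum (fun q : S × L => μ.restrict {ω | (X 0 ω, E 0 ω) = q}) = μ := by
  have hdisj : Pairwise (Function.onFun Disjoint fun q : S × L => {ω | (X 0 ω, E 0 ω) = q}) :=
    pairwise_disjoint_fiber _
  have hcover : ⋃ q : S × L, {ω | (X 0 ω, E 0 ω) = q} = Set.univ :=
    Set.iUnion_eq_univ_iff.2 fun ω => ⟨_, rfl⟩
  rw [← Measure.restrict_iUnion hdisj h.measurableSet_step, hcover, Measure.restrict_univ]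

lemma ae_pos [Countable S] [Countable L] (h : IsLabelledChain x K μ X E) (hx : ∀ s, 0 ≤ x s)
    (hK : ∀ s e s', 0 ≤ K s e s') (k : ℕ) :
    ∀ᵐ ω ∂μ, 0 < K (X k ω) (E k ω) (X (k + 1) ω) := by
  induction k generalizing x μ X E with
  | zero =>
    rw [← h.sum_restrict, Measure.ae_sum_iff]
    intro q
    have : Nonempty L := ⟨q.2⟩
    have hnull (s' : S) : ∀ᵐ ω ∂μ.restrict {ω | (X 0 ω, E 0 ω) = q},
        X 1 ω = s' → 0 < K q.1 q.2 s' := by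
      by_cases hpos : 0 < K q.1 q.2 s'
      · exact .of_forall fun _ _ => hpos
      · have hzero := (h.restrict q).measure_state s'
        rw [ENNReal.ofReal_of_nonpos
          (mul_nonpos_of_nonneg_of_nonpos (hx _) (not_lt.1 hpos))] at hzero
        exact (measure_eq_zero_iff_ae_notMem.1 hzero).mono fun ω hω h₁ => absurd h₁ hω
    filter_upwards [ae_all_iff.2 hnull, ae_restrict_mem (h.measurableSet_step q)] with ω hω hq
    subst hq
    exact hω _ rfl
  | succ k ih =>
    rw [← h.sum_restrict, Measure.ae_sum_iff]
    exact fun q => ih (h.restrict q) fun s' => mul_nonneg (hx _) (hK _ _ _)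

lemma lintegral_count_step [Countable S] [Countable L] (h : IsLabelledChain x K μ X E) (d : L → ℕ)
    (f : S → ℕ → ℝ≥0∞) (n : ℕ) :
    ∫⁻ ω, f (X 0 ω) (∑ i ∈ Finset.range (n + 1), d (E i ω)) ∂μ =
      ∑' q : S × L, ∫⁻ ω, f q.1 (d q.2 + ∑ i ∈ Finset.range n, d (E (i + 1) ω))
        ∂μ.restrict {ω | (X 0 ω, E 0 ω) = q} := by
  nth_rw 1 [← h.sum_restrict]
  rw [lintegral_sum_measure]
  refine tsum_congr fun q => lintegral_congr_ae ?_
  filter_upwards [ae_restrict_mem (h.measurableSet_step q)] with ω hω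
  subst hω
  rw [Finset.sum_range_succ', add_comm]

lemma lintegral_count_congr [Countable S] [Countable L] [Nonempty L] {Ω' : Type*}
    [MeasurableSpace Ω'] {μ' : Measure Ω'} {X' : ℕ → Ω' → S} {E' : ℕ → Ω' → L}
    (h : IsLabelledChain x K μ X E) (h' : IsLabelledChain x K μ' X' E') (d : L → ℕ)
    (f : S → ℕ → ℝ≥0∞) (n : ℕ) :
    ∫⁻ ω, f (X 0 ω) (∑ i ∈ Finset.range n, d (E i ω)) ∂μ =
      ∫⁻ ω, f (X' 0 ω) (∑ i ∈ Finset.range n, d (E' i ω)) ∂μ' := by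
  induction n generalizing x μ X E μ' X' E' f with
  | zero =>
    simp only [Finset.range_zero, Finset.sum_empty]
    rw [h.lintegral_state fun s => f s 0, h'.lintegral_state fun s => f s 0]
  | succ n ih =>
    rw [h.lintegral_count_step, h'.lintegral_count_step]
    exact tsum_congr fun q => ih (h.restrict q) (h'.restrict q) fun _ m => f q.1 (d q.2 + m)

variable [Fintype S] [Fintype L]

lemma shift_one (h : IsLabelledChain x K μ X E) (hx : ∀ s, 0 ≤ x s)
    (hK : ∀ s e s', 0 ≤ K s e s') (hstat : x ᵥ* transitionMatrix K = x) :
    IsLabelledChain x K μ (fun i => X (i + 1)) (fun i => E (i + 1)) where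
  measurable_state i := h.measurable_state (i + 1)
  measurable_label i := h.measurable_label (i + 1)
  law n s e := by
    have hprod : 0 ≤ ∏ i ∈ Finset.range n, K (s i) (e i) (s (i + 1)) :=
      Finset.prod_nonneg fun _ _ => hK _ _ _
    have hinit : ∑ q : S × L, x q.1 * K q.1 q.2 (s 0) = x (s 0) := by
      rw [Fintype.sum_prod_type]
      simpa only [vecMul, dotProduct, transitionMatrix, Finset.mul_sum] using congrFun hstat (s 0)
    rw [← h.sum_restrict, Measure.sum_apply_of_countable, tsum_fintype,
      Finset.sum_congr rfl fun q _ => (h.restrict q).law n s e,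
      ← ENNReal.ofReal_sum_of_nonneg fun q _ => mul_nonneg (mul_nonneg (hx _) (hK _ _ _)) hprod,
      ← Finset.sum_mul, hinit]

lemma shift (h : IsLabelledChain x K μ X E) (hx : ∀ s, 0 ≤ x s)
    (hK : ∀ s e s', 0 ≤ K s e s') (hstat : x ᵥ* transitionMatrix K = x) (k : ℕ) :
    IsLabelledChain x K μ (fun i => X (k + i)) (fun i => E (k + i)) := by
  induction k with
  | zero => simpa only [zero_add] using h
  | succ k ih => simpa only [add_right_comm, ← add_assoc] using ih.shift_one hx hK hstat

lemma measure_forall_lt [Nonempty L] [DecidableEq S] (h : IsLabelledChain x K μ X E)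
    (hx : ∀ s, 0 ≤ x s) (hK : ∀ s e s', 0 ≤ K s e s') (p : S → L → Prop) [DecidableRel p] (n : ℕ) :
    μ {ω | ∀ i < n, p (X i ω) (E i ω)} = ENNReal.ofReal (x ⬝ᵥ stepMatrix K p ^ n *ᵥ 1) := by
  induction n generalizing x μ X E with
  | zero => simpa [dotProduct_one] using h.measure_univ hx
  | succ n ih =>
    have hstep (q : S × L) : μ.restrict {ω | (X 0 ω, E 0 ω) = q}
        {ω | ∀ i < n + 1, p (X i ω) (E i ω)} = if p q.1 q.2 then
          ENNReal.ofReal ((fun s' => x q.1 * K q.1 q.2 s') ⬝ᵥ stepMatrix K p ^ n *ᵥ 1) else 0 := by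
      split_ifs with hq
      · rw [← ih (h.restrict q) fun s' => mul_nonneg (hx _) (hK _ _ _)]
        refine measure_congr ?_
        filter_upwards [ae_restrict_mem (h.measurableSet_step q)] with ω hω
        refine propext ?_
        subst hω
        exact Nat.forall_lt_succ_left.trans (and_iff_right hq)
      · refine measure_eq_zero_iff_ae_notMem.2 ?_
        filter_upwards [ae_restrict_mem (h.measurableSet_step q)] with ω hω hall
        exact hq (hω ▸ hall 0 n.succ_pos)
    rw [← h.sum_restrict, Measure.sum_apply_of_countable, tsum_fintype,
      Finset.sum_congr rfl fun q _ => hstep q, pow_succ', ← mulVec_mulVec,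
      dotProduct_stepMatrix_mulVec, ENNReal.ofReal_sum_of_nonneg]
    · exact Finset.sum_congr rfl fun q _ => by split_ifs; exacts [rfl, ENNReal.ofReal_zero.symm]
    · intro q _
      split_ifs
      exacts [Finset.sum_nonneg fun s' _ => mul_nonneg (mul_nonneg (hx _) (hK _ _ _))
        (pow_mulVec_one_nonneg (stepMatrix_nonneg hK) n s'), le_rfl]

lemma measure_slot [Nonempty L] (h : IsLabelledChain x K μ X E)
    (hx : ∀ s, 0 ≤ x s) (hK : ∀ s e s', 0 ≤ K s e s') (hstat : x ᵥ* transitionMatrix K = x)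
    (p : S → L → Prop) [DecidableRel p] (k : ℕ) :
    μ {ω | p (X k ω) (E k ω)} = ENNReal.ofReal (x ⬝ᵥ stepMatrix K p *ᵥ 1) := by
  classical
  have hslot := (h.shift hx hK hstat k).measure_forall_lt hx hK p 1
  simpa only [Nat.lt_one_iff, forall_eq, add_zero, pow_one] using hslot

open Filter Topology in
lemma ae_exists_not [Nonempty L] (h : IsLabelledChain x K μ X E) (hx : ∀ s, 0 ≤ x s)
    (hK : ∀ s e s', 0 ≤ K s e s') (hsum : ∀ s, ∑ e, ∑ s', K s e s' = 1) {p : S → L → Prop}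
    [DecidableRel p] (hp : ∀ A, ¬ IsClosedClass (stepMatrix K p) A) :
    ∀ᵐ ω ∂μ, ∃ i, ¬ p (X i ω) (E i ω) := by
  classical
  have hlim : Tendsto (fun n => ENNReal.ofReal (x ⬝ᵥ stepMatrix K p ^ n *ᵥ 1)) atTop (𝓝 0) := by
    rw [← ENNReal.ofReal_zero, ← dotProduct_zero x]
    have hcont : Continuous (x ⬝ᵥ ·) := Continuous.dotProduct continuous_const continuous_id
    exact ENNReal.tendsto_ofReal ((hcont.tendsto 0).comp
      (tendsto_pow_mulVec_one (stepMatrix_nonneg hK) (sum_stepMatrix_le hK hsum) hp))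
  refine le_antisymm (ge_of_tendsto' hlim fun n => ?_) zero_le
  rw [← h.measure_forall_lt hx hK p n]
  exact measure_mono fun ω hω i _ => not_not.1 fun hi => hω ⟨i, hi⟩

end IsLabelledChain

section LittlesLaw

/-- Labelled chains of a queue: `N s` tasks are present in the state `s`, in a slot with label `e`
a task enters if `a s e` and `d e` tasks leave, and the queue cannot stay nonempty forever without
a departure. -/
structure IsDrainingQueue {S L : Type*} [Fintype S] [Fintype L] (K : S → L → S → ℝ) (N : S → ℕ)
    (a : S → L → Prop) [DecidableRel a] (d : L → ℕ) : Prop where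
  nonneg : ∀ s e s', 0 ≤ K s e s'
  sum_eq_one : ∀ s, ∑ e, ∑ s', K s e s' = 1
  balance : ∀ s e s', 0 < K s e s' → N s' + d e = N s + if a s e then 1 else 0
  not_isClosedClass : ∀ A, ¬ IsClosedClass (stepMatrix K fun s e => N s ≠ 0 ∧ d e = 0) A

variable {Ω S L : Type*} {N : S → ℕ} {a : S → L → Prop} {d : L → ℕ}
  {X : ℕ → Ω → S} {E : ℕ → Ω → L}

/-- The number of slots from time `k + 1` until all tasks present at that time have left, which
under first-in-first-out service is the sojourn time of a task that enters in slot `k`. -/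
noncomputable def sojourn (N : S → ℕ) (d : L → ℕ) (X : ℕ → Ω → S) (E : ℕ → Ω → L) (k : ℕ) (ω : Ω) :
    ℕ∞ :=
  firstPassage (fun n => ∑ i ∈ Finset.range n, d (E (k + 1 + i) ω)) (N (X (k + 1) ω))

/-- The number of tasks present at time `k` that have not left `n` slots later; the truncated
subtraction gives `0` once they have all left. -/
def backlog (N : S → ℕ) (d : L → ℕ) (X : ℕ → Ω → S) (E : ℕ → Ω → L) (k n : ℕ) (ω : Ω) : ℕ :=
  N (X k ω) - ∑ i ∈ Finset.range n, d (E (k + i) ω)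

lemma monotone_sum_range {d : ℕ → ℕ} : Monotone fun n => ∑ i ∈ Finset.range n, d i :=
  fun _ _ h => Finset.sum_le_sum_of_subset (Finset.range_mono h)

lemma natCast_lt_sojourn_iff {k n : ℕ} {ω : Ω} :
    (n : ℕ∞) < sojourn N d X E k ω ↔ 0 < backlog N d X E (k + 1) n ω :=
  (natCast_lt_firstPassage_iff monotone_sum_range).trans Nat.sub_pos_iff_lt.symm

lemma backlog_succ_eq [DecidableRel a] {k : ℕ} {ω : Ω}
    (hbal : N (X (k + 1) ω) + d (E k ω) = N (X k ω) + if a (X k ω) (E k ω) then 1 else 0) (n : ℕ) :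
    backlog N d X E (k + 1) n ω = backlog N d X E k (n + 1) ω +
      {ω | a (X k ω) (E k ω) ∧ (n : ℕ∞) < sojourn N d X E k ω}.indicator 1 ω := by
  classical
  simp only [Set.indicator_apply, Set.mem_ofPred_eq, natCast_lt_sojourn_iff, backlog,
    Finset.sum_range_succ', add_zero, Pi.one_apply, add_right_comm k, ← add_assoc]
  by_cases ha : a (X k ω) (E k ω) <;> simp only [ha, if_true, if_false, true_and, false_and]
    at hbal ⊢
  · split_ifs <;> omega
  · omega

namespace IsLabelledChain

open Matrix

variable [MeasurableSpace Ω] [MeasurableSpace S] [MeasurableSingletonClass S]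
  [MeasurableSpace L] [MeasurableSingletonClass L] {x : S → ℝ} {K : S → L → S → ℝ} {μ : Measure Ω}

lemma measurable_backlog [Countable S] [Countable L] (h : IsLabelledChain x K μ X E) (k n : ℕ) :
    Measurable (backlog N d X E k n) :=
  (Measurable.of_discrete.comp (h.measurable_state k)).sub
    (Finset.measurable_sum _ fun i _ => Measurable.of_discrete.comp (h.measurable_label (k + i)))

lemma measurable_sojourn [Countable S] [Countable L] (h : IsLabelledChain x K μ X E) (k : ℕ) :
    Measurable (sojourn N d X E k) := by
  refine measurable_of_natCast_lt fun n => ?_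
  simp only [natCast_lt_sojourn_iff]
  exact measurableSet_lt measurable_const (h.measurable_backlog (k + 1) n)

lemma measurableSet_slot [Countable S] [Countable L] (h : IsLabelledChain x K μ X E)
    (a : S → L → Prop) (k : ℕ) : MeasurableSet {ω | a (X k ω) (E k ω)} :=
  ((h.measurable_state k).prodMk (h.measurable_label k))
    (.of_discrete (s := {q : S × L | a q.1 q.2}))

variable [Fintype S] [Fintype L] [DecidableRel a]

lemma ae_balance (h : IsLabelledChain x K μ X E) (hx : ∀ s, 0 ≤ x s)
    (hK : IsDrainingQueue K N a d) : ∀ᵐ ω ∂μ, ∀ k,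
      N (X (k + 1) ω) + d (E k ω) = N (X k ω) + if a (X k ω) (E k ω) then 1 else 0 :=
  ae_all_iff.2 fun k => (h.ae_pos hx hK.nonneg k).mono fun _ hpos => hK.balance _ _ _ hpos

variable [Nonempty L]

lemma ae_exists_le_departures (h : IsLabelledChain x K μ X E) (hx : ∀ s, 0 ≤ x s)
    (hstat : x ᵥ* transitionMatrix K = x) (hK : IsDrainingQueue K N a d) (k : ℕ) :
    ∀ᵐ ω ∂μ, ∃ n, N (X k ω) ≤ ∑ i ∈ Finset.range n, d (E (k + i) ω) := by
  have hrec (j : ℕ) := (h.shift hx hK.nonneg hstat (k + j)).ae_exists_not hx hK.nonneg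
    hK.sum_eq_one hK.not_isClosedClass
  filter_upwards [h.ae_balance hx hK, ae_all_iff.2 hrec] with ω hbal hrec
  refine exists_le_sum_range (N := fun i => N (X (k + i) ω)) (fun i => ?_) fun j => ?_
  · have := hbal (k + i)
    rw [← add_assoc]
    split_ifs at this <;> omega
  · obtain ⟨i, hi⟩ := hrec j
    exact ⟨i, by rw [← add_assoc]; tauto⟩

lemma ae_sojourn_ne_top (h : IsLabelledChain x K μ X E) (hx : ∀ s, 0 ≤ x s)
    (hstat : x ᵥ* transitionMatrix K = x) (hK : IsDrainingQueue K N a d) (k : ℕ) :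
    ∀ᵐ ω ∂μ, sojourn N d X E k ω ≠ ⊤ :=
  (h.ae_exists_le_departures hx hstat hK (k + 1)).mono fun _ ⟨_, hn⟩ => firstPassage_ne_top hn

lemma lintegral_backlog_succ (h : IsLabelledChain x K μ X E) (hx : ∀ s, 0 ≤ x s)
    (hstat : x ᵥ* transitionMatrix K = x) (hK : IsDrainingQueue K N a d) (k n : ℕ) :
    ∫⁻ ω, backlog N d X E k n ω ∂μ = ∫⁻ ω, backlog N d X E k (n + 1) ω ∂μ +
      μ {ω | a (X k ω) (E k ω) ∧ (n : ℕ∞) < sojourn N d X E k ω} := by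
  have hstep : ∫⁻ ω, backlog N d X E k n ω ∂μ = ∫⁻ ω, backlog N d X E (k + 1) n ω ∂μ :=
    (h.shift hx hK.nonneg hstat k).lintegral_count_congr (h.shift hx hK.nonneg hstat (k + 1)) d
      (fun s m => ((N s - m : ℕ) : ℝ≥0∞)) n
  have hset : MeasurableSet {ω | a (X k ω) (E k ω) ∧ (n : ℕ∞) < sojourn N d X E k ω} :=
    (h.measurableSet_slot a k).inter (h.measurable_sojourn k (.of_discrete (s := Set.Ioi (n : ℕ∞))))
  rw [hstep, ← lintegral_indicator_one hset,
    ← lintegral_add_right _ (measurable_one.indicator hset)]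
  refine lintegral_congr_ae ((h.ae_balance hx hK).mono fun ω hbal => ?_)
  simp only [backlog_succ_eq (hbal k), Nat.cast_add, Set.indicator_apply, Pi.one_apply,
    Nat.cast_ite, Nat.cast_one, Nat.cast_zero]

lemma lintegral_length (h : IsLabelledChain x K μ X E) (hx : ∀ s, 0 ≤ x s)
    (hstat : x ᵥ* transitionMatrix K = x) (hK : IsDrainingQueue K N a d) (k : ℕ) :
    ∫⁻ ω, N (X k ω) ∂μ = ENNReal.ofReal (∑ s, N s * x s) := by
  have hmean := (h.shift hx hK.nonneg hstat k).lintegral_state fun s => (N s : ℝ≥0∞)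
  rw [add_zero, tsum_fintype] at hmean
  rw [hmean, ENNReal.ofReal_sum_of_nonneg fun s _ => mul_nonneg (Nat.cast_nonneg _) (hx s)]
  exact Finset.sum_congr rfl fun s _ => by
    rw [ENNReal.ofReal_mul (Nat.cast_nonneg _), ENNReal.ofReal_natCast]

open Filter Topology

lemma tendsto_lintegral_backlog (h : IsLabelledChain x K μ X E) (hx : ∀ s, 0 ≤ x s)
    (hstat : x ᵥ* transitionMatrix K = x) (hK : IsDrainingQueue K N a d) (k : ℕ) :
    Tendsto (fun n => ∫⁻ ω, backlog N d X E k n ω ∂μ) atTop (𝓝 0) := by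
  rw [← lintegral_zero (μ := μ)]
  refine tendsto_lintegral_of_dominated_convergence (fun ω => (N (X k ω) : ℝ≥0∞))
    (fun n => Measurable.of_discrete.comp (h.measurable_backlog k n))
    (fun n => .of_forall fun ω => Nat.cast_le.2 (Nat.sub_le _ _)) ?_ ?_
  · rw [h.lintegral_length hx hstat hK]
    exact ENNReal.ofReal_ne_top
  · filter_upwards [h.ae_exists_le_departures hx hstat hK k] with ω ⟨n, hn⟩
    refine tendsto_const_nhds.congr' ((eventually_ge_atTop n).mono fun m hm => ?_)
    have hzero : backlog N d X E k m ω = 0 :=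
      Nat.sub_eq_zero_of_le (hn.trans (monotone_sum_range hm))
    simp only [hzero, Nat.cast_zero]

theorem setLIntegral_sojourn (h : IsLabelledChain x K μ X E) (hx : ∀ s, 0 ≤ x s)
    (hstat : x ᵥ* transitionMatrix K = x) (hK : IsDrainingQueue K N a d) (k : ℕ) :
    ∫⁻ ω in {ω | a (X k ω) (E k ω)}, (sojourn N d X E k ω : ℝ≥0∞) ∂μ =
      ENNReal.ofReal (∑ s, N s * x s) := by
  have hpartial (M : ℕ) : ∑ n ∈ Finset.range M,
      μ {ω | a (X k ω) (E k ω) ∧ (n : ℕ∞) < sojourn N d X E k ω} +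
        ∫⁻ ω, backlog N d X E k M ω ∂μ = ∫⁻ ω, N (X k ω) ∂μ := by
    induction M with
    | zero => rw [Finset.sum_range_zero, zero_add]; rfl
    | succ M ih => rw [← ih, Finset.sum_range_succ, add_assoc, add_comm (μ _),
        ← h.lintegral_backlog_succ hx hstat hK]
  have hlim := (ENNReal.tendsto_nat_tsum fun n : ℕ =>
    μ {ω | a (X k ω) (E k ω) ∧ (n : ℕ∞) < sojourn N d X E k ω}).add
      (h.tendsto_lintegral_backlog hx hstat hK k)
  simp only [hpartial, add_zero] at hlim
  rw [lintegral_toENNReal_eq_tsum_lt (h.measurable_sojourn k), ← h.lintegral_length hx hstat hK k,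
    tendsto_nhds_unique tendsto_const_nhds hlim]
  exact tsum_congr fun n => (Measure.restrict_apply' (h.measurableSet_slot a k)).trans
    (congrArg μ (Set.inter_comm _ _))

lemma ae_length_eq_zero (h : IsLabelledChain x K μ X E) (hx : ∀ s, 0 ≤ x s)
    (hstat : x ᵥ* transitionMatrix K = x) (hK : IsDrainingQueue K N a d) {k : ℕ}
    (hzero : μ {ω | a (X k ω) (E k ω)} = 0) : ∀ᵐ ω ∂μ, N (X k ω) = 0 := by
  have hmean : ∫⁻ ω, N (X k ω) ∂μ = 0 := by
    rw [h.lintegral_length hx hstat hK, ← h.setLIntegral_sojourn hx hstat hK k,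
      Measure.restrict_eq_zero.2 hzero, lintegral_zero_measure]
  have hmeas : Measurable fun ω => (N (X k ω) : ℝ≥0∞) :=
    (Measurable.of_discrete (f := fun s => (N s : ℝ≥0∞))).comp (h.measurable_state k)
  exact ((lintegral_eq_zero_iff hmeas).1 hmean).mono fun ω hω => Nat.cast_eq_zero.1 hω

end IsLabelledChain

end LittlesLaw

lemma exists_pos_of_sum_pos {ι : Type*} [Fintype ι] {f : ι → ℝ} (h : 0 < ∑ i, f i) :
    ∃ i, 0 < f i := by
  by_contra! hf
  exact h.not_ge (Finset.sum_nonpos fun i _ => hf i)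

namespace DPH

variable {n : ℕ}

lemma exit_nonneg (F : DPH n) (i : Fin n) : 0 ≤ F.exit i :=
  sub_nonneg.2 (F.row_sum_le i)

lemma exists_mem_exit_pos (F : DPH n) {J : Set (Fin n)} (hJ : J.Nonempty)
    (hclosed : ∀ i ∈ J, ∀ j, 0 < F.trans i j → j ∈ J) : ∃ i ∈ J, 0 < F.exit i := by
  by_contra! hexit
  exact not_isClosedClass_of_isUnit F.trans_nonneg F.nonsingular J ⟨hJ, fun i hi =>
    ⟨(F.row_sum_le i).antisymm (sub_nonpos.1 (hexit i hi)), hclosed i hi⟩⟩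

lemma sum_trans (F : DPH n) (i : Fin n) : ∑ j, F.trans i j = 1 - F.exit i :=
  (sub_sub_cancel _ _).symm

end DPH

namespace DMAP

variable {m : ℕ}

lemma step_nonneg (A : DMAP m) (c : Bool) (i j : Fin m) : 0 ≤ A.step c i j := by
  cases c
  exacts [A.D0_nonneg i j, A.D1_nonneg i j]

lemma step_false_add_step_true (A : DMAP m) : A.step false + A.step true = A.D0 + A.D1 := rfl

lemma sum_step (A : DMAP m) (i : Fin m) : ∑ c, ∑ j, A.step c i j = 1 := by
  rw [Fintype.sum_bool, add_comm, ← Finset.sum_add_distrib]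
  exact A.row_sum i

end DMAP

namespace TandemQueue

variable {Q : TandemQueue}

namespace State

lemma len₁_eq_zero_iff (s : Q.State) : s.len₁ = 0 ↔ s.srv₁ = none := s.2.1

lemma srv₁_ne_transmission (s : Q.State) (h : s.len₂ = Q.N₂) (j : Fin Q.n₁) :
    s.srv₁ ≠ some (Sum.inr j) := s.2.2.1 h j

lemma len₂_eq_zero_iff (s : Q.State) : s.len₂ = 0 ↔ s.srv₂ = none := s.2.2.2

lemma len₁_le (s : Q.State) : s.len₁ ≤ Q.N₁ := Nat.lt_succ_iff.1 s.1.1.2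

lemma len₂_le (s : Q.State) : s.len₂ ≤ Q.N₂ := Nat.lt_succ_iff.1 s.1.2.1.2

lemma len₁_ne_zero {s : Q.State} {j : Fin Q.l ⊕ Fin Q.n₁} (h : s.srv₁ = some j) : s.len₁ ≠ 0 :=
  fun h' => Option.some_ne_none j (h.symm.trans (s.len₁_eq_zero_iff.1 h'))

lemma len₂_ne_zero {s : Q.State} {j : Fin Q.n₂} (h : s.srv₂ = some j) : s.len₂ ≠ 0 :=
  fun h' => Option.some_ne_none j (h.symm.trans (s.len₂_eq_zero_iff.1 h'))

lemma ext {s t : Q.State} (h₁ : s.len₁ = t.len₁) (h₂ : s.len₂ = t.len₂)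
    (hphase : s.phase = t.phase) (hsrv₁ : s.srv₁ = t.srv₁) (hsrv₂ : s.srv₂ = t.srv₂) : s = t :=
  Subtype.ext (Prod.ext (Fin.ext h₁) (Prod.ext (Fin.ext h₂)
    (Prod.ext hphase (Prod.ext hsrv₁ hsrv₂))))

end State

section Dynamics

variable {s : Q.State} {e : Event}

lemma moved_transmission {j : Fin Q.n₁} (h : s.srv₁ = some (Sum.inr j)) :
    Q.moved s e = if e.end₁ then 1 else 0 := by
  simp only [moved, h]

lemma moved_vacation {j : Fin Q.l} (h : s.srv₁ = some (Sum.inl j)) : Q.moved s e = 0 := by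
  simp only [moved, h]

lemma moved_idle (h : s.srv₁ = none) : Q.moved s e = 0 := by
  simp only [moved, h]

lemma moved_eq_zero (h : e.end₁ = false) : Q.moved s e = 0 := by
  rcases hs : s.srv₁ with _ | j | j
  · exact moved_idle hs
  · exact moved_vacation hs
  · rw [moved_transmission hs, h, if_neg Bool.false_ne_true]

lemma moved_le_len₁ (s : Q.State) (e : Event) : Q.moved s e ≤ s.len₁ := by
  rcases h : s.srv₁ with _ | j | j
  · exact (moved_idle h).trans_le (Nat.zero_le _)
  · exact (moved_vacation h).trans_le (Nat.zero_le _)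
  · have := State.len₁_ne_zero h
    rw [moved_transmission h]
    split_ifs <;> omega

lemma next₁_le (s : Q.State) (e : Event) : Q.next₁ s e ≤ Q.N₁ := by
  have := s.len₁_le
  unfold next₁
  split_ifs with h
  · exact h.2
  · omega

lemma next₂_le (s : Q.State) (e : Event) : Q.next₂ s e ≤ Q.N₂ := by
  have := s.len₂_le
  rw [next₂]
  rcases h : s.srv₁ with _ | j | j
  · rw [moved_idle h]; omega
  · rw [moved_vacation h]; omega
  · have : s.len₂ ≠ Q.N₂ := fun h' => s.srv₁_ne_transmission h' j h
    rw [moved_transmission h]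
    split_ifs <;> omega

end Dynamics

section Servers

lemma start₁_nonneg (i₁ i₂ : ℕ) (a : Q.Status₁) : 0 ≤ Q.start₁ i₁ i₂ a := by
  rcases a with _ | j | j <;> rw [start₁] <;> split_ifs
  exacts [zero_le_one, le_rfl, Q.vac.init_nonneg j, le_rfl, Q.trm.init_nonneg j, le_rfl]

lemma start₂_nonneg (i₂ : ℕ) (b : Q.Status₂) : 0 ≤ Q.start₂ i₂ b := by
  rcases b with _ | j <;> rw [start₂] <;> split_ifs
  exacts [zero_le_one, le_rfl, Q.cmp.init_nonneg j, le_rfl]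

lemma sum_start₁ (i₁ i₂ : ℕ) : ∑ a, Q.start₁ i₁ i₂ a = 1 := by
  rw [Fintype.sum_option, Fintype.sum_sum_type]
  by_cases h : i₁ = 0 <;> by_cases h' : i₂ = Q.N₂ <;>
    simp [start₁, h, h', Q.vac.init_sum, Q.trm.init_sum]

lemma sum_start₂ (i₂ : ℕ) : ∑ b, Q.start₂ i₂ b = 1 := by
  rw [Fintype.sum_option]
  by_cases h : i₂ = 0 <;> simp [start₂, h, Q.cmp.init_sum]

lemma valid_of_start₁_ne_zero {i₁ i₂ : ℕ} {a : Q.Status₁} (h : Q.start₁ i₁ i₂ a ≠ 0) :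
    (i₁ = 0 ↔ a = none) ∧ (i₂ = Q.N₂ → ∀ j : Fin Q.n₁, a ≠ some (Sum.inr j)) := by
  rcases a with _ | j | j <;> simp [start₁] at h ⊢ <;> tauto

lemma valid_of_start₂_ne_zero {i₂ : ℕ} {b : Q.Status₂} (h : Q.start₂ i₂ b ≠ 0) :
    i₂ = 0 ↔ b = none := by
  rcases b with _ | j <;> simp [start₂] at h ⊢ <;> tauto

lemma step₁_nonneg (i₁ i₂ : ℕ) (a : Q.Status₁) (c : Bool) (a' : Q.Status₁) :
    0 ≤ Q.step₁ i₁ i₂ a c a' := by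
  rcases a with _ | j | j <;> cases c
  · exact start₁_nonneg _ _ _
  · exact le_rfl
  · rcases a' with _ | j' | _
    exacts [le_rfl, Q.vac.trans_nonneg _ _, le_rfl]
  · exact mul_nonneg (Q.vac.exit_nonneg _) (start₁_nonneg _ _ _)
  · rcases a' with _ | _ | j'
    exacts [le_rfl, le_rfl, Q.trm.trans_nonneg _ _]
  · exact mul_nonneg (Q.trm.exit_nonneg _) (start₁_nonneg _ _ _)

lemma step₂_nonneg (i₂ : ℕ) (b : Q.Status₂) (c : Bool) (b' : Q.Status₂) :
    0 ≤ Q.step₂ i₂ b c b' := by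
  rcases b with _ | j <;> cases c
  · exact start₂_nonneg _ _
  · exact le_rfl
  · rcases b' with _ | j'
    exacts [le_rfl, Q.cmp.trans_nonneg _ _]
  · exact mul_nonneg (Q.cmp.exit_nonneg _) (start₂_nonneg _ _)

/-- The probability that the activity of server 1 ends (`true`) or does not end (`false`) in a
slot; idleness never counts as ending. -/
def endProb₁ (Q : TandemQueue) (a : Q.Status₁) (c : Bool) : ℝ :=
  match a, c with
  | none, true => 0
  | none, false => 1
  | some (Sum.inl j), true => Q.vac.exit j
  | some (Sum.inl j), false => 1 - Q.vac.exit j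
  | some (Sum.inr j), true => Q.trm.exit j
  | some (Sum.inr j), false => 1 - Q.trm.exit j

/-- The analogue of `endProb₁` for server 2. -/
def endProb₂ (Q : TandemQueue) (b : Q.Status₂) (c : Bool) : ℝ :=
  match b, c with
  | none, true => 0
  | none, false => 1
  | some j, true => Q.cmp.exit j
  | some j, false => 1 - Q.cmp.exit j

lemma sum_step₁ (i₁ i₂ : ℕ) (a : Q.Status₁) (c : Bool) :
    ∑ a', Q.step₁ i₁ i₂ a c a' = Q.endProb₁ a c := by
  rcases a with _ | j | j <;> cases c
  · exact sum_start₁ _ _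
  · exact Finset.sum_const_zero
  · simp [Fintype.sum_option, step₁, endProb₁, DPH.sum_trans]
  · simp only [step₁, endProb₁, ← Finset.mul_sum, sum_start₁, mul_one]
  · simp [Fintype.sum_option, step₁, endProb₁, DPH.sum_trans]
  · simp only [step₁, endProb₁, ← Finset.mul_sum, sum_start₁, mul_one]

lemma sum_step₂ (i₂ : ℕ) (b : Q.Status₂) (c : Bool) :
    ∑ b', Q.step₂ i₂ b c b' = Q.endProb₂ b c := by
  rcases b with _ | j <;> cases c
  · exact sum_start₂ _
  · exact Finset.sum_const_zero
  · simp [Fintype.sum_option, step₂, endProb₂, DPH.sum_trans]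
  · simp only [step₂, endProb₂, ← Finset.mul_sum, sum_start₂, mul_one]

lemma sum_endProb₁ (a : Q.Status₁) : ∑ c, Q.endProb₁ a c = 1 := by
  rcases a with _ | j | j <;> simp [endProb₁]

lemma sum_endProb₂ (b : Q.Status₂) : ∑ c, Q.endProb₂ b c = 1 := by
  rcases b with _ | j <;> simp [endProb₂]

variable {s : Q.State} {e : Event}

lemma valid_of_step₁_ne_zero {a : Q.Status₁}
    (h : Q.step₁ (Q.next₁ s e) (Q.next₂ s e) s.srv₁ e.end₁ a ≠ 0) :
    (Q.next₁ s e = 0 ↔ a = none) ∧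
      (Q.next₂ s e = Q.N₂ → ∀ j : Fin Q.n₁, a ≠ some (Sum.inr j)) := by
  rcases hs : s.srv₁ with _ | j | j <;> rcases he : e.end₁ with _ | _ <;> rw [hs, he] at h
  · exact valid_of_start₁_ne_zero h
  · exact absurd rfl h
  · have hnext₁ : Q.next₁ s e ≠ 0 := by
      have := State.len₁_ne_zero hs
      rw [next₁, moved_eq_zero he]
      omega
    rcases a with _ | j' | j'
    exacts [absurd rfl h, by simp [hnext₁], absurd rfl h]
  · exact valid_of_start₁_ne_zero (right_ne_zero_of_mul h)
  · have hnext₁ : Q.next₁ s e ≠ 0 := by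
      have := State.len₁_ne_zero hs
      rw [next₁, moved_eq_zero he]
      omega
    have hnext₂ : Q.next₂ s e ≠ Q.N₂ := by
      have := s.len₂_le
      have : s.len₂ ≠ Q.N₂ := fun h' => s.srv₁_ne_transmission h' j hs
      rw [next₂, moved_eq_zero he]
      omega
    rcases a with _ | j' | j'
    exacts [absurd rfl h, absurd rfl h, by simp [hnext₁, hnext₂]]
  · exact valid_of_start₁_ne_zero (right_ne_zero_of_mul h)

lemma valid_of_step₂_ne_zero {b : Q.Status₂}
    (h : Q.step₂ (Q.next₂ s e) s.srv₂ e.end₂ b ≠ 0) : Q.next₂ s e = 0 ↔ b = none := by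
  rcases hs : s.srv₂ with _ | j <;> rcases he : e.end₂ with _ | _ <;> rw [hs, he] at h
  · exact valid_of_start₂_ne_zero h
  · exact absurd rfl h
  · have hnext₂ : Q.next₂ s e ≠ 0 := by
      have := State.len₂_ne_zero hs
      rw [next₂, he, if_neg Bool.false_ne_true]
      omega
    rcases b with _ | j'
    exacts [absurd rfl h, by simp [hnext₂]]
  · exact valid_of_start₂_ne_zero (right_ne_zero_of_mul h)

lemma exists_state (p : Fin Q.m) {a : Q.Status₁} {b : Q.Status₂}
    (ha : Q.step₁ (Q.next₁ s e) (Q.next₂ s e) s.srv₁ e.end₁ a ≠ 0)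
    (hb : Q.step₂ (Q.next₂ s e) s.srv₂ e.end₂ b ≠ 0) :
    ∃ s' : Q.State, s'.len₁ = Q.next₁ s e ∧ s'.len₂ = Q.next₂ s e ∧
      (s'.phase, s'.srv₁, s'.srv₂) = (p, a, b) :=
  ⟨⟨(⟨Q.next₁ s e, Nat.lt_succ_of_le (next₁_le s e)⟩,
    ⟨Q.next₂ s e, Nat.lt_succ_of_le (next₂_le s e)⟩, p, a, b),
    (valid_of_step₁_ne_zero ha).1, (valid_of_step₁_ne_zero ha).2, valid_of_step₂_ne_zero hb⟩,
    rfl, rfl, rfl⟩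

end Servers

section Kernel

lemma kernel_nonneg (s : Q.State) (e : Event) (s' : Q.State) : 0 ≤ Q.kernel s e s' := by
  unfold kernel
  split_ifs
  exacts [mul_nonneg (mul_nonneg (Q.arr.step_nonneg _ _ _) (step₁_nonneg _ _ _ _ _))
    (step₂_nonneg _ _ _ _), le_rfl]

open Finset in
lemma sum_kernel_mul (s : Q.State) (e : Event) (g : Fin Q.m → ℝ) :
    ∑ s', Q.kernel s e s' * g s'.phase = (∑ p, Q.arr.step e.arrival s.phase p * g p) *
      Q.endProb₁ s.srv₁ e.end₁ * Q.endProb₂ s.srv₂ e.end₂ := by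
  have hprod : (∑ p, Q.arr.step e.arrival s.phase p * g p) *
      Q.endProb₁ s.srv₁ e.end₁ * Q.endProb₂ s.srv₂ e.end₂ =
      ∑ q : Fin Q.m × Q.Status₁ × Q.Status₂, Q.arr.step e.arrival s.phase q.1 * g q.1 *
        Q.step₁ (Q.next₁ s e) (Q.next₂ s e) s.srv₁ e.end₁ q.2.1 *
          Q.step₂ (Q.next₂ s e) s.srv₂ e.end₂ q.2.2 := by
    simp only [Fintype.sum_prod_type, ← mul_sum, ← sum_mul, sum_step₁, sum_step₂]
  simp only [kernel, ite_mul, zero_mul]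
  rw [hprod, ← sum_filter]
  refine sum_of_injOn (fun s' : Q.State => (s'.phase, s'.srv₁, s'.srv₂)) ?_
    (fun _ _ => mem_coe.2 (mem_univ _)) (fun ⟨p, a, b⟩ _ hq => ?_) fun s' hs' => ?_
  · intro s' hs' t' ht' h
    simp only [coe_filter, mem_univ, true_and, Set.mem_ofPred_eq] at hs' ht'
    simp only [Prod.mk.injEq] at h
    exact State.ext (hs'.1.trans ht'.1.symm) (hs'.2.trans ht'.2.symm) h.1 h.2.1 h.2.2
  · by_contra hne
    obtain ⟨s', hlen₁, hlen₂, hs'⟩ := exists_state p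
      (right_ne_zero_of_mul (left_ne_zero_of_mul hne)) (right_ne_zero_of_mul hne)
    exact hq ⟨s', by simp [hlen₁, hlen₂], hs'⟩
  · obtain ⟨hlen₁, hlen₂⟩ := (mem_filter.1 hs').2
    rw [hlen₁, hlen₂]
    ring

lemma sum_kernel_arrival_mul (s : Q.State) (c : Bool) (g : Fin Q.m → ℝ) :
    ∑ d : Bool × Bool, ∑ s', Q.kernel s (c, d) s' * g s'.phase =
      ∑ p, Q.arr.step c s.phase p * g p := by
  simp only [sum_kernel_mul, Fintype.sum_prod_type, Event.arrival, Event.end₁, Event.end₂,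
    ← Finset.mul_sum, sum_endProb₁, sum_endProb₂, mul_one]

lemma sum_kernel (s : Q.State) : ∑ e, ∑ s', Q.kernel s e s' = 1 := by
  have harrival (c : Bool) := sum_kernel_arrival_mul s c fun _ => 1
  simp only [mul_one] at harrival
  rw [Fintype.sum_prod_type, Fintype.sum_congr _ _ harrival, DMAP.sum_step]

variable {s s' : Q.State} {e : Event}

lemma len₁_eq_of_kernel_pos (h : 0 < Q.kernel s e s') : s'.len₁ = Q.next₁ s e := by
  by_contra hlen
  exact h.ne' (if_neg fun h' => hlen h'.1)

lemma len₂_eq_of_kernel_pos (h : 0 < Q.kernel s e s') : s'.len₂ = Q.next₂ s e := by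
  by_contra hlen
  exact h.ne' (if_neg fun h' => hlen h'.2)

lemma steps_ne_zero_of_kernel_pos (h : 0 < Q.kernel s e s') :
    Q.step₁ s'.len₁ s'.len₂ s.srv₁ e.end₁ s'.srv₁ ≠ 0 ∧
      Q.step₂ s'.len₂ s.srv₂ e.end₂ s'.srv₂ ≠ 0 := by
  rw [kernel, if_pos ⟨len₁_eq_of_kernel_pos h, len₂_eq_of_kernel_pos h⟩] at h
  exact ⟨right_ne_zero_of_mul (left_ne_zero_of_mul h.ne'), right_ne_zero_of_mul h.ne'⟩

lemma exists_kernel_pos {p : Fin Q.m} {a : Q.Status₁} {b : Q.Status₂}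
    (hp : 0 < Q.arr.step e.arrival s.phase p)
    (ha : 0 < Q.step₁ (Q.next₁ s e) (Q.next₂ s e) s.srv₁ e.end₁ a)
    (hb : 0 < Q.step₂ (Q.next₂ s e) s.srv₂ e.end₂ b) :
    ∃ s', s'.srv₁ = a ∧ s'.srv₂ = b ∧ 0 < Q.kernel s e s' := by
  obtain ⟨s', hlen₁, hlen₂, hs'⟩ := exists_state p ha.ne' hb.ne'
  simp only [Prod.mk.injEq] at hs'
  refine ⟨s', hs'.2.1, hs'.2.2, ?_⟩
  rw [kernel, if_pos ⟨hlen₁, hlen₂⟩, hlen₁, hlen₂, hs'.1, hs'.2.1, hs'.2.2]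
  exact mul_pos (mul_pos hp ha) hb

/-- The number of tasks in the system. -/
def State.numTasks (s : Q.State) : ℕ := s.len₁ + s.len₂

/-- The number (0 or 1) of tasks that leave the system in the slot. -/
def Event.numDepartures (e : Event) : ℕ := if e.end₂ then 1 else 0

lemma numTasks_add_numDepartures (h : 0 < Q.kernel s e s') :
    s'.numTasks + e.numDepartures = s.numTasks + if Q.Admits s e then 1 else 0 := by
  have hmoved := moved_le_len₁ s e
  have hleave : e.numDepartures ≤ s.len₂ := by
    rcases hsrv : s.srv₂ with _ | j <;> rcases he : e.end₂ with _ | _ <;>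
      simp only [Event.numDepartures, he, if_true, Bool.false_eq_true, if_false, Nat.zero_le]
    · exact absurd (by rw [hsrv, he]; rfl) (steps_ne_zero_of_kernel_pos h).2
    · exact Nat.one_le_iff_ne_zero.2 (State.len₂_ne_zero hsrv)
  simp only [State.numTasks, Event.numDepartures, len₁_eq_of_kernel_pos h,
    len₂_eq_of_kernel_pos h, next₁, next₂] at hleave ⊢
  omega

lemma sum_numTasks_mul (x : Q.State → ℝ) : ∑ s, s.numTasks * x s = Q.meanNumber x := by
  have hmem₁ (s : Q.State) : s.len₁ ∈ Finset.range (Q.N₁ + 1) :=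
    Finset.mem_range.2 (Nat.lt_succ_of_le s.len₁_le)
  have hmem₂ (s : Q.State) : s.len₂ ∈ Finset.range (Q.N₂ + 1) :=
    Finset.mem_range.2 (Nat.lt_succ_of_le s.len₂_le)
  simp only [meanNumber, levelProb, Finset.mul_sum]
  rw [Finset.sum_congr rfl fun i _ => Finset.sum_comm, Finset.sum_comm]
  refine Finset.sum_congr rfl fun s _ => ?_
  simp only [mul_ite, mul_zero, ite_and, Finset.sum_ite_eq, hmem₁, hmem₂, if_true,
    Finset.sum_ite_irrel, Finset.sum_const_zero, State.numTasks, Nat.cast_add]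

end Kernel

section Draining

lemma exists_arrival_step_pos (i : Fin Q.m) : ∃ c p, 0 < Q.arr.step c i p := by
  obtain ⟨c, hc⟩ := exists_pos_of_sum_pos (zero_lt_one.trans_eq (Q.arr.sum_step i).symm)
  exact ⟨c, exists_pos_of_sum_pos hc⟩

lemma exists_step₁_pos (a : Q.Status₁) : ∃ c, ∀ i₁ i₂, ∃ a', 0 < Q.step₁ i₁ i₂ a c a' := by
  obtain ⟨c, hc⟩ := exists_pos_of_sum_pos (zero_lt_one.trans_eq (sum_endProb₁ a).symm)
  exact ⟨c, fun i₁ i₂ => exists_pos_of_sum_pos (hc.trans_eq (sum_step₁ i₁ i₂ a c).symm)⟩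

lemma exists_step₂_pos (b : Q.Status₂) : ∃ c, ∀ i₂, ∃ b', 0 < Q.step₂ i₂ b c b' := by
  obtain ⟨c, hc⟩ := exists_pos_of_sum_pos (zero_lt_one.trans_eq (sum_endProb₂ b).symm)
  exact ⟨c, fun i₂ => exists_pos_of_sum_pos (hc.trans_eq (sum_step₂ i₂ b c).symm)⟩

lemma exists_kernel_pos₁ (s : Q.State) {c : Bool} {R : Set Q.Status₁}
    (h : ∀ i₁ i₂, ∃ a ∈ R, 0 < Q.step₁ i₁ i₂ s.srv₁ c a) :
    ∃ e s', e.end₁ = c ∧ s'.srv₁ ∈ R ∧ 0 < Q.kernel s e s' := by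
  obtain ⟨c₀, p, hp⟩ := exists_arrival_step_pos s.phase
  obtain ⟨c₂, hc₂⟩ := exists_step₂_pos s.srv₂
  obtain ⟨a, haR, ha⟩ := h (Q.next₁ s (c₀, c, c₂)) (Q.next₂ s (c₀, c, c₂))
  obtain ⟨b, hb⟩ := hc₂ (Q.next₂ s (c₀, c, c₂))
  obtain ⟨s', rfl, -, hpos⟩ := exists_kernel_pos (e := (c₀, c, c₂)) hp ha hb
  exact ⟨_, s', rfl, haR, hpos⟩

lemma exists_kernel_pos₂ (s : Q.State) {c : Bool} {R : Set Q.Status₂}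
    (h : ∀ i₂, ∃ b ∈ R, 0 < Q.step₂ i₂ s.srv₂ c b) :
    ∃ e s', e.end₂ = c ∧ s'.srv₂ ∈ R ∧ 0 < Q.kernel s e s' := by
  obtain ⟨c₀, p, hp⟩ := exists_arrival_step_pos s.phase
  obtain ⟨c₁, hc₁⟩ := exists_step₁_pos s.srv₁
  obtain ⟨a, ha⟩ := hc₁ (Q.next₁ s (c₀, c₁, c)) (Q.next₂ s (c₀, c₁, c))
  obtain ⟨b, hbR, hb⟩ := h (Q.next₂ s (c₀, c₁, c))
  obtain ⟨s', -, rfl, hpos⟩ := exists_kernel_pos (e := (c₀, c₁, c)) hp ha hb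
  exact ⟨_, s', rfl, hbR, hpos⟩

variable {A : Set Q.State} (hA : ∀ s ∈ A, ∀ e s', 0 < Q.kernel s e s' → s' ∈ A)
include hA

lemma exists_mem_kernel_pos_end₁ {n : ℕ} (F : DPH n) (status : Fin n → Q.Status₁)
    (hstep : ∀ i₁ i₂ j j', Q.step₁ i₁ i₂ (status j) false (status j') = F.trans j j')
    (hend : ∀ j, Q.endProb₁ (status j) true = F.exit j) {s : Q.State} (hs : s ∈ A) {j : Fin n}
    (hj : s.srv₁ = status j) :
    ∃ t ∈ A, ∃ j', t.srv₁ = status j' ∧ ∃ e t', e.end₁ = true ∧ 0 < Q.kernel t e t' := by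
  obtain ⟨j', ⟨t, ht, hj'⟩, hexit⟩ := F.exists_mem_exit_pos (J := {j | ∃ t ∈ A, t.srv₁ = status j})
    ⟨j, s, hs, hj⟩ fun i ⟨t, ht, hi⟩ j' hij => by
      obtain ⟨e, t', -, hj', hpos⟩ := exists_kernel_pos₁ t (c := false) (R := {status j'})
        fun i₁ i₂ => ⟨_, rfl, by rwa [hi, hstep]⟩
      exact ⟨t', hA t ht e t' hpos, hj'⟩
  obtain ⟨e, t', he, -, hpos⟩ := exists_kernel_pos₁ t (c := true) (R := Set.univ) fun i₁ i₂ =>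
    (exists_pos_of_sum_pos (by rwa [hj', sum_step₁ i₁ i₂, hend])).imp fun _ h => ⟨trivial, h⟩
  exact ⟨t, ht, j', hj', e, t', he, hpos⟩

lemma exists_mem_kernel_pos_end₂ {s : Q.State} (hs : s ∈ A) {j : Fin Q.n₂} (hj : s.srv₂ = some j) :
    ∃ t ∈ A, ∃ e t', e.end₂ = true ∧ 0 < Q.kernel t e t' := by
  obtain ⟨j', ⟨t, ht, hj'⟩, hexit⟩ :=
    Q.cmp.exists_mem_exit_pos (J := {j | ∃ t ∈ A, t.srv₂ = some j})
      ⟨j, s, hs, hj⟩ fun i ⟨t, ht, hi⟩ j' hij => by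
        obtain ⟨e, t', -, hj', hpos⟩ := exists_kernel_pos₂ t (c := false) (R := {some j'})
          fun i₂ => ⟨_, rfl, by rwa [hi]⟩
        exact ⟨t', hA t ht e t' hpos, hj'⟩
  obtain ⟨e, t', he, -, hpos⟩ := exists_kernel_pos₂ t (c := true) (R := Set.univ) fun i₂ =>
    (exists_pos_of_sum_pos (by rwa [hj', sum_step₂ i₂])).imp fun _ h => ⟨trivial, h⟩
  exact ⟨t, ht, e, t', he, hpos⟩

lemma len₂_eq_zero_of_no_departure
    (hdep : ∀ s ∈ A, ∀ e s', 0 < Q.kernel s e s' → e.end₂ = false) {s : Q.State} (hs : s ∈ A) :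
    s.len₂ = 0 := by
  rw [s.len₂_eq_zero_iff]
  by_contra hsrv
  obtain ⟨j, hj⟩ := Option.ne_none_iff_exists'.1 hsrv
  obtain ⟨t, ht, e, t', he, hpos⟩ := exists_mem_kernel_pos_end₂ hA hs hj
  exact Bool.false_ne_true ((hdep t ht e t' hpos).symm.trans he)

variable (hdep : ∀ s ∈ A, ∀ e s', 0 < Q.kernel s e s' → e.end₂ = false)
include hdep

lemma not_transmitting_of_no_departure {s : Q.State} (hs : s ∈ A) (j : Fin Q.n₁) :
    s.srv₁ ≠ some (Sum.inr j) := by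
  intro hj
  obtain ⟨t, ht, j', hj', e, t', he, hpos⟩ := exists_mem_kernel_pos_end₁ hA Q.trm
    (fun j => some (Sum.inr j)) (fun _ _ _ _ => rfl) (fun _ => rfl) hs hj
  have hlen := len₂_eq_of_kernel_pos hpos
  rw [next₂, moved_transmission hj', he, hdep t ht e t' hpos,
    len₂_eq_zero_of_no_departure hA hdep (hA t ht e t' hpos)] at hlen
  simp at hlen

lemma not_on_vacation_of_no_departure {s : Q.State} (hs : s ∈ A) (j : Fin Q.l) :
    s.srv₁ ≠ some (Sum.inl j) := by
  intro hj
  obtain ⟨t, ht, j', hj', e, t', he, hpos⟩ := exists_mem_kernel_pos_end₁ hA Q.vac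
    (fun j => some (Sum.inl j)) (fun _ _ _ _ => rfl) (fun _ => rfl) hs hj
  have ht' := hA t ht e t' hpos
  have hlen₂ := len₂_eq_zero_of_no_departure hA hdep ht'
  rcases hsrv : t'.srv₁ with _ | j'' | j''
  · have hlen₁ := len₁_eq_of_kernel_pos hpos
    have := State.len₁_ne_zero hj'
    rw [t'.len₁_eq_zero_iff.2 hsrv, next₁, moved_vacation hj'] at hlen₁
    omega
  · have hstart := (steps_ne_zero_of_kernel_pos hpos).1
    have := Q.N₁_lt_N₂
    rw [hj', he, hsrv] at hstart
    refine hstart (mul_eq_zero_of_right _ (if_neg ?_))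
    omega
  · exact not_transmitting_of_no_departure hA hdep ht' j'' hsrv

end Draining

theorem isDrainingQueue (Q : TandemQueue) :
    IsDrainingQueue Q.kernel State.numTasks Q.Admits Event.numDepartures where
  nonneg := kernel_nonneg
  sum_eq_one := sum_kernel
  balance _ _ _ := numTasks_add_numDepartures
  not_isClosedClass A hA := by
    have hpos {s : Q.State} (hs : s ∈ A) {e : Event} {s' : Q.State} (h : 0 < Q.kernel s e s') :=
      hA.of_pos kernel_nonneg sum_kernel hs h
    have hclosed : ∀ s ∈ A, ∀ e s', 0 < Q.kernel s e s' → s' ∈ A := fun s hs e s' h => (hpos hs h).2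
    have hdep : ∀ s ∈ A, ∀ e s', 0 < Q.kernel s e s' → e.end₂ = false := fun s hs e s' h => by
      simpa [Event.numDepartures] using (hpos hs h).1.2
    obtain ⟨s, hs⟩ := hA.1
    obtain ⟨c, hc⟩ := exists_pos_of_sum_pos (zero_lt_one.trans_eq (sum_kernel s).symm)
    obtain ⟨s', hs'⟩ := exists_pos_of_sum_pos hc
    refine (hpos hs hs').1.1 ?_
    rw [State.numTasks, len₂_eq_zero_of_no_departure hclosed hdep hs, add_zero,
      s.len₁_eq_zero_iff, Option.eq_none_iff_forall_ne_some]
    rintro (j | j)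
    · exact not_on_vacation_of_no_departure hclosed hdep hs j
    · exact not_transmitting_of_no_departure hclosed hdep hs j

section Phase

open Matrix

/-- The matrix that maps a distribution of the state to the distribution of its arrival phase. -/
def phaseMatrix (Q : TandemQueue) : Matrix Q.State (Fin Q.m) ℝ :=
  fun s p => if s.phase = p then 1 else 0

lemma phaseMatrix_mulVec_one : Q.phaseMatrix *ᵥ 1 = 1 := by
  ext s
  simp [mulVec, dotProduct, phaseMatrix]

lemma stepMatrix_mul_phaseMatrix (c : Bool) :
    stepMatrix Q.kernel (fun _ e => e.arrival = c) * Q.phaseMatrix =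
      Q.phaseMatrix * Q.arr.step c := by
  ext s p
  have hsum := sum_kernel_arrival_mul s c fun p' => if p' = p then 1 else 0
  simp only [mul_apply, stepMatrix, Finset.sum_mul, ite_mul, zero_mul]
  rw [Finset.sum_comm, Fintype.sum_prod_type, Fintype.sum_eq_single c]
  · simpa [Event.arrival, phaseMatrix] using hsum
  · intro c' hc'
    simp [Event.arrival, hc']

lemma stepMatrix_arrival_false_add_true :
    stepMatrix Q.kernel (fun _ e => e.arrival = false) +
      stepMatrix Q.kernel (fun _ e => e.arrival = true) = Q.P := by
  ext s s'
  simp only [Matrix.add_apply, stepMatrix, P, ← Finset.sum_add_distrib]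
  refine Finset.sum_congr rfl fun e _ => ?_
  by_cases h : e.arrival = true <;> simp [h]

variable {x : Q.State → ℝ}

lemma IsStationary.vecMul_phaseMatrix (hx : Q.IsStationary x) :
    Q.arr.IsStationary (x ᵥ* Q.phaseMatrix) := by
  refine ⟨fun p => Finset.sum_nonneg fun s _ => mul_nonneg (hx.1 s) ?_, ?_, ?_⟩
  · dsimp only [phaseMatrix]
    split_ifs
    exacts [zero_le_one, le_rfl]
  · rw [← dotProduct_one, ← dotProduct_mulVec, phaseMatrix_mulVec_one, dotProduct_one, hx.2.1]
  · rw [← DMAP.step_false_add_step_true, vecMul_vecMul, Matrix.mul_add,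
      ← stepMatrix_mul_phaseMatrix, ← stepMatrix_mul_phaseMatrix, ← Matrix.add_mul,
      stepMatrix_arrival_false_add_true, ← vecMul_vecMul, hx.2.2]

lemma rate_vecMul_phaseMatrix (x : Q.State → ℝ) :
    Q.arr.rate (x ᵥ* Q.phaseMatrix) =
      x ⬝ᵥ stepMatrix Q.kernel (fun _ e => e.arrival = true) *ᵥ 1 := by
  have hstep : Q.arr.D1 = Q.arr.step true := rfl
  rw [DMAP.rate, hstep, vecMul_vecMul, ← stepMatrix_mul_phaseMatrix, ← dotProduct_one,
    ← dotProduct_mulVec, ← mulVec_mulVec, phaseMatrix_mulVec_one]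

end Phase

instance instMeasurableSpaceState : MeasurableSpace Q.State := ⊤

instance instDiscreteMeasurableSpaceState : DiscreteMeasurableSpace Q.State := ⟨fun _ => trivial⟩

namespace IsRun

variable {Ω : Type*} [MeasurableSpace Ω] {x : Q.State → ℝ} {μ : Measure Ω}
  {X : ℕ → Ω → Q.State} {E : ℕ → Ω → Event}

lemma isLabelledChain (h : Q.IsRun x μ X E) : IsLabelledChain x Q.kernel μ X E where
  measurable_state i := measurable_to_countable' (h.measurable_state i)
  measurable_label i := measurable_to_countable' (h.measurable_event i)
  law := h.law

lemma measurable_delay (h : Q.IsRun x μ X E) (k : ℕ) : Measurable (Q.delay X E k) :=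
  h.isLabelledChain.measurable_sojourn (N := State.numTasks) (d := Event.numDepartures) k

lemma offloadingRatio_eq_div (h : Q.IsRun x μ X E) (k : ℕ) :
    Q.offloadingRatio μ X E k = (μ (Q.enters X E k)).toReal / (μ (arrives E k)).toReal := by
  have hmeas : MeasurableSet (arrives E k) :=
    h.isLabelledChain.measurableSet_slot (fun _ e => e.arrival = true) k
  have hsub : Q.enters X E k ⊆ arrives E k := fun ω hω => hω.1
  rw [offloadingRatio, cond_apply hmeas, Set.inter_eq_right.2 hsub, ENNReal.toReal_mul,
    ENNReal.toReal_inv, div_eq_inv_mul]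

variable (hx : Q.IsStationary x)
include hx

lemma measure_arrives (h : Q.IsRun x μ X E) (k : ℕ) :
    μ (arrives E k) = ENNReal.ofReal (Q.arr.rate (Matrix.vecMul x Q.phaseMatrix)) := by
  rw [rate_vecMul_phaseMatrix]
  exact h.isLabelledChain.measure_slot hx.1 kernel_nonneg hx.2.2 (fun _ e => e.arrival = true) k

lemma ae_delay_ne_top (h : Q.IsRun x μ X E) (k : ℕ) : ∀ᵐ ω ∂μ, Q.delay X E k ω ≠ ⊤ :=
  h.isLabelledChain.ae_sojourn_ne_top hx.1 hx.2.2 Q.isDrainingQueue k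

lemma setLIntegral_delay (h : Q.IsRun x μ X E) (k : ℕ) :
    ∫⁻ ω in Q.enters X E k, (Q.delay X E k ω : ℝ≥0∞) ∂μ = ENNReal.ofReal (Q.meanNumber x) :=
  (h.isLabelledChain.setLIntegral_sojourn hx.1 hx.2.2 Q.isDrainingQueue k).trans
    (congrArg ENNReal.ofReal (sum_numTasks_mul x))

lemma measure_enters_ne_zero (h : Q.IsRun x μ X E) {k : ℕ} (harr : μ (arrives E k) ≠ 0) :
    μ (Q.enters X E k) ≠ 0 := by
  intro hzero
  refine harr (measure_mono_null_ae ?_ hzero)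
  filter_upwards [h.isLabelledChain.ae_length_eq_zero hx.1 hx.2.2 Q.isDrainingQueue hzero]
    with ω hempty harr
  have := Q.one_le_N₁
  have : (X k ω).len₁ + (X k ω).len₂ = 0 := hempty
  exact ⟨harr, by omega⟩

lemma averageDelay_eq_tsum (h : Q.IsRun x μ X E) (k : ℕ) :
    Q.averageDelay μ X E k = ∑' n : ℕ, ((n + 1 : ℕ) : ℝ≥0∞) * Q.delayProb μ X E k (n + 1) :=
  lintegral_toENNReal_eq_tsum_mul (h.measurable_delay k)
    (cond_absolutelyContinuous.ae_le (h.ae_delay_ne_top hx k))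

lemma averageDelay_eq_div (h : Q.IsRun x μ X E) (k : ℕ) :
    Q.averageDelay μ X E k = ENNReal.ofReal (Q.meanNumber x) / μ (Q.enters X E k) := by
  rw [averageDelay, ProbabilityTheory.cond, lintegral_smul_measure, h.setLIntegral_delay hx,
    smul_eq_mul, ENNReal.div_eq_inv_mul]

end IsRun

end TandemQueue

theorem proposition2 (Q : TandemQueue)
    (π : Fin Q.m → ℝ) (hπ : Q.arr.IsStationary π)
    (hπ_unique : ∀ π' : Fin Q.m → ℝ, Q.arr.IsStationary π' → π' = π)
    (hrate : 0 < Q.arr.rate π)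
    (x : Q.State → ℝ) (hx : Q.IsStationary x)
    {Ω : Type*} [MeasurableSpace Ω] (μ : Measure Ω) [IsProbabilityMeasure μ]
    (X : ℕ → Ω → Q.State) (E : ℕ → Ω → TandemQueue.Event) (hrun : Q.IsRun x μ X E) (k : ℕ) :
    0 < Q.offloadingRatio μ X E k ∧
    Q.averageDelay μ X E k = ∑' n : ℕ, ((n + 1 : ℕ) : ℝ≥0∞) * Q.delayProb μ X E k (n + 1) ∧
    Q.averageDelay μ X E k =
      ENNReal.ofReal (Q.meanNumber x / (Q.arr.rate π * Q.offloadingRatio μ X E k)) := by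
  have harr : μ (TandemQueue.arrives E k) = ENNReal.ofReal (Q.arr.rate π) := by
    rw [hrun.measure_arrives hx, hπ_unique _ hx.vecMul_phaseMatrix]
  have hent : 0 < (μ (Q.enters X E k)).toReal :=
    ENNReal.toReal_pos (hrun.measure_enters_ne_zero hx (harr ▸ (ENNReal.ofReal_pos.2 hrate).ne'))
      (measure_ne_top _ _)
  have hratio : Q.offloadingRatio μ X E k = (μ (Q.enters X E k)).toReal / Q.arr.rate π := by
    rw [hrun.offloadingRatio_eq_div, harr, ENNReal.toReal_ofReal hrate.le]
  refine ⟨hratio ▸ div_pos hent hrate, hrun.averageDelay_eq_tsum hx k, ?_⟩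
  rw [hratio, mul_div_cancel₀ _ hrate.ne', ENNReal.ofReal_div_of_pos hent,
    ENNReal.ofReal_toReal (measure_ne_top _ _), hrun.averageDelay_eq_div hx]
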